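/- Let $\Pi\subset\mathbb Z^2$ be a finite simply connected cell complex made of elementary squares of the lattice. Its even vertices ($m+n$ even) carry rings, its odd vertices carry points. Two even vertices are neighbours if they are opposite corners of a square of $\Pi$. An even vertex with four neighbours is called inner, all other even vertices are called boundary vertices; $V(v)$ denotes the number of neighbours of $v$. **Patterns.** A ring at $v$ consists of two concentric circles in the unit sphere $S^2$: an outer circle $C_v$ of spherical radius $R_v\in(0,\pi/2)$ and an inner circle $c_v$ of spherical radius $|r_v|\le R_v$, $r_v\neq 0$, where the sign of $r_v$ is the orientation of the ring ($r_v>0$ is counterclockwise). An *orthogonal ring pattern* on $\Pi$ consists of such rings at the even vertices and points $\ell\in S^2$ at the odd vertices, such that: 1. for neighbouring even vertices $v,w$, and an odd vertex of their common square which is a horizontal lattice neighbour of $v$ (hence a vertical one of $w$), the circles $c_v$ and $C_w$ pass through the point $\ell$ at this odd vertex and intersect there orthogonally; 2. for each square of $\Pi$ and each of its even corners $v$, the oriented angle $\theta$ at the centre of the ring at $v$ between its two points in this square (taken in the cyclic order right, up, left, down) lies in $(0,\pi)$ if $r_v>0$ and in $(-\pi,0)$ if $r_v<0$; and at an inner vertex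 the four points go round the centre exactly once, i.e. the four angles sum up to $2\pi\operatorname{sign}(r_v)$. The sum $\Theta(v)$ of the angles $\theta$ at $v$ over all squares containing $v$ is the *cone angle* at $v$. The pattern has *parameter* $q\in(0,1]$ if $q\cos r_v=\cos R_v$ for all $v$. With $K=K(q)$ the quarter period of the Jacobi elliptic functions of modulus $q$ ($K=\infty$ for $q=1$), its variables $\beta_v\in[0,2K]$ are then defined by $\operatorname{sn}(\beta_v,q)=\cos r_v$, $\operatorname{cn}(\beta_v,q)=\sin r_v$, i.e. $\beta_v=\int_0^{\pi/2-r_v}\frac{dt}{\sqrt{1-q^2\sin^2 t}}$. An *orthogonal circle pattern* is an orthogonal ring pattern with $r_v=R_v$ for all $v$; it has parameter $q=1$, and $\beta_v=\log\cot\frac{R_v}{2}>0$. **Boundary value problems.** In the *Dirichlet problem* the radii of the boundary rings are prescribed through their variables $\beta_v$; the free vertices are the inner ones. In the *Neumann problem* the cone angles $\Theta(v)$ of the boundary rings are prescribed; all even vertices are free. **Rigidity.** Let $F(x)=\int_0^x\arctan(\sinh u)\,du$ and $$S_{\rm sph}(\beta)=\sum_{(jk)}\bigl(F(\beta_j-\beta_k)-F(\beta_j+\beta_k)\bigr)+\sum_j\Phi_j\beta_j,$$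 where the first sum is over all pairs of neighbours, $\Phi_j=2\pi$ at inner vertices, and $\Phi_j=\pi V(j)-\Theta(j)$ at boundary vertices in the Neumann problem (in the Dirichlet problem the $\beta_j$ at boundary vertices are fixed and their $\Phi_j$ do not matter). Let $f_i=\partial S_{\rm sph}/\partial\beta_i$ for the free vertices $i$. A circle pattern with variables $\beta^0$ that solves a boundary value problem is *rigid* if no $\phi\ne0$ supported on the free vertices satisfies $f_i(\beta^0+t\phi)=o(t)$ as $t\to0$ for all free $i$; equivalently, if the Hessian of $S_{\rm sph}$ with respect to the free variables is nondegenerate at $\beta^0$. **Theorem.** Let an orthogonal circle pattern $\mathcal C$ on $\Pi$ be a rigid solution of a Dirichlet or Neumann boundary value problem. Then there are $\varepsilon_0>0$ and a family $\mathcal P_\varepsilon$, $0\le\varepsilon<\varepsilon_0$, of orthogonal ring patterns on $\Pi$ with $\mathcal P_0=\mathcal C$, such that $\mathcal P_\varepsilon$ has parameter $q=1-\varepsilon$ and solves the same boundary value problem as $\mathcal C$, and such that the radii, the centres of the rings, and the points of $\mathcal P_\varepsilon$ depend continuously on $\varepsilon\in[0,\varepsilon_0)$. -/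

import Mathlib

open scoped Real Topology InnerProductSpace

noncomputable section

namespace RingPattern

/-! ### Square complexes in the lattice `ℤ²` -/

/-- A finite cell complex made of elementary squares of `ℤ²`; a square is named by its lower left
corner. -/
abbrev SquareComplex := Finset (ℤ × ℤ)

/-- The four corners of the elementary square with lower left corner `s`. -/
def corners (s : ℤ × ℤ) : Finset (ℤ × ℤ) :=
  {s, (s.1 + 1, s.2), (s.1, s.2 + 1), (s.1 + 1, s.2 + 1)}

/-- All vertices of the complex. -/
def vertices (Q : SquareComplex) : Finset (ℤ × ℤ) := Q.biUnion corners

/-- The vertices with even coordinate sum; they carry the rings. -/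
def ringVertices (Q : SquareComplex) : Finset (ℤ × ℤ) :=
  {v ∈ vertices Q | Even (v.1 + v.2)}

/-- The vertices with odd coordinate sum; they carry the touching points. -/
def pointVertices (Q : SquareComplex) : Finset (ℤ × ℤ) :=
  {v ∈ vertices Q | Odd (v.1 + v.2)}

/-- The 1-skeleton of the complex. -/
def edgeGraph (Q : SquareComplex) : SimpleGraph (ℤ × ℤ) where
  Adj u v := |u.1 - v.1| + |u.2 - v.2| = 1 ∧ ∃ s ∈ Q, u ∈ corners s ∧ v ∈ corners s
  symm := ⟨fun u v h => by
    obtain ⟨h1, s, hs, hu, hv⟩ := h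
    exact ⟨by rwa [abs_sub_comm v.1, abs_sub_comm v.2], s, hs, hv, hu⟩⟩
  loopless := ⟨fun u h => by simp at h⟩

/-- Combinatorial homotopy (with fixed end points) of edge paths of the complex: generated by
inserting or deleting a backtracking step, and by replacing two consecutive sides of a square of
the complex by the other two sides. -/
inductive EdgeHomotopic (Q : SquareComplex) :
    ∀ {u v : ℤ × ℤ}, (edgeGraph Q).Walk u v → (edgeGraph Q).Walk u v → Prop
  | refl {u v : ℤ × ℤ} (p : (edgeGraph Q).Walk u v) : EdgeHomotopic Q p p
  | symm {u v : ℤ × ℤ} {p p' : (edgeGraph Q).Walk u v} :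
      EdgeHomotopic Q p p' → EdgeHomotopic Q p' p
  | trans {u v : ℤ × ℤ} {p p' p'' : (edgeGraph Q).Walk u v} :
      EdgeHomotopic Q p p' → EdgeHomotopic Q p' p'' → EdgeHomotopic Q p p''
  | cons {u v w : ℤ × ℤ} (h : (edgeGraph Q).Adj u v) {p p' : (edgeGraph Q).Walk v w} :
      EdgeHomotopic Q p p' → EdgeHomotopic Q (.cons h p) (.cons h p')
  | backtrack {u v w : ℤ × ℤ} (h : (edgeGraph Q).Adj u v) (h' : (edgeGraph Q).Adj v u)
      (p : (edgeGraph Q).Walk u w) : EdgeHomotopic Q (.cons h (.cons h' p)) p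
  | square {s a b c d w : ℤ × ℤ} (hs : s ∈ Q)
      (ha : a ∈ corners s) (hb : b ∈ corners s) (hc : c ∈ corners s) (hd : d ∈ corners s)
      (hab : (edgeGraph Q).Adj a b) (hbc : (edgeGraph Q).Adj b c)
      (had : (edgeGraph Q).Adj a d) (hdc : (edgeGraph Q).Adj d c)
      (p : (edgeGraph Q).Walk c w) :
      EdgeHomotopic Q (.cons hab (.cons hbc p)) (.cons had (.cons hdc p))

/-- The complex is connected and its edge path group is trivial. -/
def SimplyConnected (Q : SquareComplex) : Prop :=
  (∀ u ∈ vertices Q, ∀ v ∈ vertices Q, (edgeGraph Q).Reachable u v) ∧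
    ∀ u ∈ vertices Q, ∀ p : (edgeGraph Q).Walk u u, EdgeHomotopic Q p .nil

/-- The square that has `v` and `v + (a, b)` (with `a, b = ±1`) as opposite corners belongs to the
complex. For even `v` this says that the rings at `v` and `v + (a, b)` are neighbours. -/
def HasSquare (Q : SquareComplex) (v : ℤ × ℤ) (a b : ℤˣ) : Prop :=
  (min v.1 (v.1 + a), min v.2 (v.2 + b)) ∈ Q

instance (Q : SquareComplex) (v : ℤ × ℤ) (a b : ℤˣ) : Decidable (HasSquare Q v a b) := by
  unfold HasSquare; infer_instance

/-- The vertex diagonally opposite to `v`. -/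
def diagVertex (v : ℤ × ℤ) (a b : ℤˣ) : ℤ × ℤ := (v.1 + a, v.2 + b)

/-- The horizontal neighbour of `v` in `ℤ²`. -/
def horVertex (v : ℤ × ℤ) (a : ℤˣ) : ℤ × ℤ := (v.1 + a, v.2)

/-- The vertical neighbour of `v` in `ℤ²`. -/
def verVertex (v : ℤ × ℤ) (b : ℤˣ) : ℤ × ℤ := (v.1, v.2 + b)

/-- The number of neighbouring rings of the ring at `v`. -/
def valence (Q : SquareComplex) (v : ℤ × ℤ) : ℕ :=
  (Finset.univ.filter fun d : ℤˣ × ℤˣ => HasSquare Q v d.1 d.2).card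

/-- The vertices of inner rings: those with four neighbouring rings. -/
def innerRings (Q : SquareComplex) : Finset (ℤ × ℤ) :=
  {v ∈ ringVertices Q | valence Q v = 4}

/-- The vertices of boundary rings: those with fewer than four neighbouring rings. -/
def boundaryRings (Q : SquareComplex) : Finset (ℤ × ℤ) :=
  {v ∈ ringVertices Q | valence Q v < 4}

/-! ### Circles and rings in the 2-sphere -/

/-- The unit sphere in Euclidean 3-space. -/
abbrev S2 := Metric.sphere (0 : EuclideanSpace ℝ (Fin 3)) 1

/-- The circle with centre `k` and spherical radius `ρ`. -/
def sphericalCircle (k : S2) (ρ : ℝ) : Set S2 :=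
  {x | InnerProductGeometry.angle (x : EuclideanSpace ℝ (Fin 3)) k = ρ}

/-- The component of `y` tangent to the sphere at `x`: it points along the great circle from `x`
to `y`. -/
def tangentPart (x y : S2) : EuclideanSpace ℝ (Fin 3) :=
  (y : EuclideanSpace ℝ (Fin 3)) -
    ⟪(x : EuclideanSpace ℝ (Fin 3)), (y : EuclideanSpace ℝ (Fin 3))⟫_ℝ •
      (x : EuclideanSpace ℝ (Fin 3))

/-- Two circles with centres `k₁` and `k₂` through the point `x` are orthogonal at `x`: their radial
directions at `x` are orthogonal. -/
def OrthogonalAt (x k₁ k₂ : S2) : Prop :=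
  ⟪tangentPart x k₁, tangentPart x k₂⟫_ℝ = 0

/-- The determinant of three vectors. For points `y`, `z` in the sphere `det3 x y z > 0` says that
the rotation about `x` from the direction of `y` to the direction of `z` by an angle in `(0, π)`
is counterclockwise, seen from outside. -/
def det3 (x y z : S2) : ℝ :=
  Matrix.det (Matrix.of ![(x : EuclideanSpace ℝ (Fin 3)).ofLp,
    (y : EuclideanSpace ℝ (Fin 3)).ofLp, (z : EuclideanSpace ℝ (Fin 3)).ofLp])

/-- The oriented angle in `(-π, π]` at `x` from the direction of `y` to the direction of `z`. -/
def orientedAngle (x y z : S2) : ℝ :=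
  Complex.arg ⟨⟪tangentPart x y, tangentPart x z⟫_ℝ, det3 x y z⟩

/-- A family of rings, indexed by the even vertices, and of points, indexed by the odd vertices.
The ring at `v` has centre `center v`, outer radius `R v`, and inner radius `r v` with a sign that
stands for the orientation of the ring. Only values at the vertices of a given complex, of the
parity in question, matter. -/
@[ext]
structure Rings where
  center : ℤ × ℤ → S2
  point : ℤ × ℤ → S2
  r : ℤ × ℤ → ℝ
  R : ℤ × ℤ → ℝ

/-- The angle `θ` at the centre of the ring at `v` in the quadrilateral that this ring spans with
the ring at `v + (a, b)`: the oriented angle between the two touching points. The order of the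
points is right, up, left, down: from the horizontal to the vertical one if `a b = 1`, and
the other way round if `a b = -1`. -/
def Rings.theta (P : Rings) (v : ℤ × ℤ) (a b : ℤˣ) : ℝ :=
  if a = b then orientedAngle (P.center v) (P.point (horVertex v a)) (P.point (verVertex v b))
  else orientedAngle (P.center v) (P.point (verVertex v b)) (P.point (horVertex v a))

/-- The cone angle `Θ(v)`: the sum of the angles `θ` over all neighbouring rings. -/
def Rings.coneAngle (Q : SquareComplex) (P : Rings) (v : ℤ × ℤ) : ℝ :=
  ∑ d : ℤˣ × ℤˣ, if HasSquare Q v d.1 d.2 then P.theta v d.1 d.2 else 0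

/-- Orthogonal spherical ring patterns with all rings contained in open half-spheres. -/
structure IsRingPattern (Q : SquareComplex) (P : Rings) : Prop where
  /-- The circle of radius `|r|` is the inner one, and the ring is oriented. -/
  r_ne_zero : ∀ v ∈ ringVertices Q, P.r v ≠ 0
  abs_r_le : ∀ v ∈ ringVertices Q, |P.r v| ≤ P.R v
  R_lt : ∀ v ∈ ringVertices Q, P.R v < π / 2
  /-- Inner circles pass through the touching points at the horizontal neighbours. -/
  mem_inner : ∀ v ∈ ringVertices Q, ∀ a b : ℤˣ, HasSquare Q v a b →
    P.point (horVertex v a) ∈ sphericalCircle (P.center v) |P.r v|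
  /-- Outer circles pass through the touching points at the vertical neighbours. -/
  mem_outer : ∀ v ∈ ringVertices Q, ∀ a b : ℤˣ, HasSquare Q v a b →
    P.point (verVertex v b) ∈ sphericalCircle (P.center v) (P.R v)
  /-- The inner circle of a ring is orthogonal to the outer circle of each neighbouring ring. By
  symmetry this covers both pairs of circles of two neighbouring rings. -/
  orthogonal : ∀ v ∈ ringVertices Q, ∀ a b : ℤˣ, HasSquare Q v a b →
    OrthogonalAt (P.point (horVertex v a)) (P.center v) (P.center (diagVertex v a b))
  /-- Consecutive touching points of a ring are in counterclockwise order if `r > 0`, and in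
  clockwise order if `r < 0`. -/
  orientation : ∀ v ∈ ringVertices Q, ∀ a b : ℤˣ, HasSquare Q v a b →
    0 < P.r v * P.theta v a b ∧ |P.theta v a b| < π
  /-- The four touching points of an inner ring go round the centre exactly once, in the
  direction given by the sign of `r`. -/
  closing : ∀ v ∈ innerRings Q, P.coneAngle Q v = SignType.sign (P.r v) * (2 * π)

/-- All rings of the pattern are related by `q cos r = cos R`. -/
def HasParameter (Q : SquareComplex) (P : Rings) (q : ℝ) : Prop :=
  ∀ v ∈ ringVertices Q, q * Real.cos (P.r v) = Real.cos (P.R v)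

/-- Orthogonal circle patterns: ring patterns in which the two circles of every ring coincide, with
positive orientation. -/
def IsCirclePattern (Q : SquareComplex) (P : Rings) : Prop :=
  IsRingPattern Q P ∧ ∀ v ∈ ringVertices Q, P.r v = P.R v

/-! ### The uniformizing variable and the boundary value problems -/

/-- The incomplete elliptic integral of the first kind with modulus `q`. Its inverse is the
amplitude function, so `sn (ellipticF q φ, q) = sin φ` and `cn (ellipticF q φ, q) = cos φ`. -/
def ellipticF (q φ : ℝ) : ℝ := ∫ t in (0 : ℝ)..φ, 1 / √(1 - q ^ 2 * Real.sin t ^ 2)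

/-- The uniformizing variable `β ∈ [0, 2K]` of a ring with inner radius `r` in a pattern with
parameter `q`: the solution of `sn (β, q) = cos r`, `cn (β, q) = sin r`. -/
def uniformizer (q r : ℝ) : ℝ := ellipticF q (π / 2 - r)

/-- The boundary value problems. Dirichlet: the radii of the boundary rings are prescribed, through
the uniformizing variable `β`. Neumann: the cone angles of the boundary rings are prescribed. -/
inductive BoundaryProblem
  | dirichlet (b : ℤ × ℤ → ℝ)
  | neumann (Θ : ℤ × ℤ → ℝ)

/-- The boundary conditions, for a ring pattern with parameter `q`. -/
def BoundaryProblem.Holds (B : BoundaryProblem) (Q : SquareComplex) (P : Rings) (q : ℝ) : Prop :=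
  match B with
  | .dirichlet b => ∀ v ∈ boundaryRings Q, uniformizer q (P.r v) = b v
  | .neumann Θ => ∀ v ∈ boundaryRings Q, P.coneAngle Q v = Θ v

/-- The rings whose variables are free: the inner ones in the Dirichlet problem, all of them in the
Neumann problem. -/
def BoundaryProblem.freeRings (B : BoundaryProblem) (Q : SquareComplex) : Finset (ℤ × ℤ) :=
  match B with
  | .dirichlet _ => innerRings Q
  | .neumann _ => ringVertices Q

/-! ### The functional for circle patterns and rigidity -/

/-- `F(x) = ∫₀ˣ arctan (sinh u) du`. -/
def circleF (x : ℝ) : ℝ := ∫ u in (0 : ℝ)..x, Real.arctan (Real.sinh u)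

/-- The coefficients `Φ` of the functional: `2π` at inner rings, and `π V - Θ` at boundary rings in
the Neumann problem. In the Dirichlet problem the variables of the boundary rings are fixed and
their coefficients are irrelevant. -/
def BoundaryProblem.phi (B : BoundaryProblem) (Q : SquareComplex) (v : ℤ × ℤ) : ℝ :=
  if v ∈ innerRings Q then 2 * π
  else match B with
    | .dirichlet _ => 0
    | .neumann Θ => π * valence Q v - Θ v

/-- The two even corners of a square. -/
def edgeEnds (s : ℤ × ℤ) : (ℤ × ℤ) × (ℤ × ℤ) :=
  if Even (s.1 + s.2) then (s, (s.1 + 1, s.2 + 1)) else ((s.1 + 1, s.2), (s.1, s.2 + 1))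

/-- The functional `S_sph` for circle patterns. Pairs of neighbouring rings correspond to the
squares of the complex. -/
def BoundaryProblem.functional (B : BoundaryProblem) (Q : SquareComplex) (β : ℤ × ℤ → ℝ) : ℝ :=
  ∑ s ∈ Q, (circleF (β (edgeEnds s).1 - β (edgeEnds s).2)
      - circleF (β (edgeEnds s).1 + β (edgeEnds s).2))
    + ∑ v ∈ ringVertices Q, B.phi Q v * β v

/-- The partial derivative `f_i = ∂S_sph/∂β_i`. -/
def BoundaryProblem.governing (B : BoundaryProblem) (Q : SquareComplex) (i : ℤ × ℤ)
    (β : ℤ × ℤ → ℝ) : ℝ :=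
  deriv (fun t => B.functional Q (Function.update β i t)) (β i)

/-- `φ`, supported on the free rings, is an infinitesimal deformation at `β`: the governing
equations hold along `β + t φ` up to `o(t)`. -/
def BoundaryProblem.IsInfinitesimalDeformation (B : BoundaryProblem) (Q : SquareComplex)
    (β φ : ℤ × ℤ → ℝ) : Prop :=
  (∀ v, v ∉ B.freeRings Q → φ v = 0) ∧
    ∀ i ∈ B.freeRings Q,
      (fun t : ℝ => B.governing Q i (fun v => β v + t * φ v)) =o[𝓝 0] (fun t : ℝ => t)

/-- A circle pattern is rigid as a solution of the boundary value problem `B` if it has no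
nontrivial infinitesimal deformation. -/
def BoundaryProblem.Rigid (B : BoundaryProblem) (Q : SquareComplex) (P : Rings) : Prop :=
  ∀ φ : ℤ × ℤ → ℝ,
    B.IsInfinitesimalDeformation Q (fun v => uniformizer 1 (P.R v)) φ → φ = 0

/-- For circles the uniformizing variable is `log cot (R / 2)`. -/
theorem uniformizer_one {R : ℝ} (h0 : 0 < R) (h1 : R < π) :
    uniformizer 1 R = Real.log (Real.cot (R / 2)) := by
  have key : ∀ t ∈ Set.uIcc 0 (π / 2 - R), 0 < Real.cos t ∧ 0 < Real.sin ((π / 2 - t) / 2) ∧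
      0 < Real.cos ((π / 2 - t) / 2) := by
    intro t ht
    have ht' : -(π / 2) < t ∧ t < π / 2 := by
      rcases Set.mem_uIcc.1 ht with h | h <;> constructor <;> linarith [h.1, h.2, Real.pi_pos]
    refine ⟨Real.cos_pos_of_mem_Ioo ht', Real.sin_pos_of_pos_of_lt_pi ?_ ?_,
      Real.cos_pos_of_mem_Ioo ⟨?_, ?_⟩⟩ <;> linarith [ht'.1, ht'.2, Real.pi_pos]
  have hint : Set.EqOn (fun t => 1 / √(1 - (1 : ℝ) ^ 2 * Real.sin t ^ 2))
      (fun t => (Real.cos t)⁻¹) (Set.uIcc 0 (π / 2 - R)) := by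
    intro t ht
    have h : 1 - (1 : ℝ) ^ 2 * Real.sin t ^ 2 = Real.cos t ^ 2 := by
      have := Real.sin_sq_add_cos_sq t; linarith
    simp only [h, Real.sqrt_sq (key t ht).1.le, one_div]
  have hder : ∀ t ∈ Set.uIcc 0 (π / 2 - R), HasDerivAt
      (fun t => Real.log (Real.cos ((π / 2 - t) / 2)) - Real.log (Real.sin ((π / 2 - t) / 2)))
      (Real.cos t)⁻¹ t := by
    intro t ht
    obtain ⟨-, h2, h3⟩ := key t ht
    have hx : HasDerivAt (fun t : ℝ => (π / 2 - t) / 2) (-1 / 2) t :=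
      ((hasDerivAt_id t).const_sub (π / 2)).div_const 2
    have hd := (hx.cos.log h3.ne').sub (hx.sin.log h2.ne')
    refine hd.congr_deriv ?_
    have hc : Real.cos t =
        2 * Real.sin ((π / 2 - t) / 2) * Real.cos ((π / 2 - t) / 2) := by
      rw [← Real.sin_two_mul, show 2 * ((π / 2 - t) / 2) = π / 2 - t by ring,
        Real.sin_pi_div_two_sub]
    rw [hc]
    have hs := Real.sin_sq_add_cos_sq ((π / 2 - t) / 2)
    generalize (π / 2 - t) / 2 = x at h2 h3 hs ⊢
    field_simp
    linarith
  have hcont : ContinuousOn (fun t => (Real.cos t)⁻¹) (Set.uIcc 0 (π / 2 - R)) :=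
    Real.continuous_cos.continuousOn.inv₀ fun t ht => (key t ht).1.ne'
  have hR := key (π / 2 - R) Set.right_mem_uIcc
  have e : (π / 2 - (π / 2 - R)) / 2 = R / 2 := by ring
  rw [e] at hR
  unfold uniformizer ellipticF
  rw [intervalIntegral.integral_congr hint,
    intervalIntegral.integral_eq_sub_of_hasDerivAt hder hcont.intervalIntegrable, e,
    Real.cot_eq_cos_div_sin, Real.log_div hR.2.2.ne' hR.2.1.ne']
  have e4 : (π / 2 - 0) / 2 = π / 4 := by ring
  rw [e4, Real.cos_pi_div_four, Real.sin_pi_div_four]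
  ring

end RingPattern

end

/-! For two neighbouring rings with centres V, W and touching points l, l', the quadrilateral V l W
l' has right angles at l and l'. The arc VW cuts it into two right-angled spherical triangles, with
legs (r, R') and (R, r'). Their hypotenuses agree because cos r cos R' = cos R cos r', which follows
from a common parameter q. So the radii determine the angles at the centres (`kiteAngle`), and the
proof splits into finding radii whose angles add up correctly and laying out a pattern with these
radii.

Radii. Put cos r = tanh x and cos R = q tanh x. The angle sums (`kiteSum`) are then C¹ in (q, x)
near q = 1. At q = 1 the variable x is the uniformizing variable β, and f_i is the angle sum at i
minus its prescribed value (`governing_eq`). Rigidity therefore says that the derivative of the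
angle sums at the free rings with respect to the free variables is injective. Hence the map from (q,
x) to q, the angle sums at the free rings and x at the other rings has invertible derivative, and
the inverse function theorem lifts the curve q = 1 - ε with constant angle sums
(`exists_variables`). For q < 1 the variable x differs from β, so Dirichlet data turn into moving
boundary values of x. These are found by inverting the elliptic integral, which is monotone in x
(`exists_uniformizer_eq`).

Layout. Each edge carries a frame in SO(3) at either end. Passing along an edge of length d
multiplies by `halfTurn d`, and turning at a vertex multiplies by `rotZ`. The new pattern arises
from C by rotating each centre and point by its own element of SO(3). The quotients of these
elements along edges are prescribed by `edgeTransport`, they are compatible around a square because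
the kite with the new radii closes (`kite_closes`), and simple connectivity integrates them
(`exists_potential`). At ε = 0 all transports are trivial, so the family starts at C itself and
inherits continuity. That C has frames of this kind is the content of `kite_rigid`: orthogonality
and orientation force the kite angles and the sense of the right angles. -/

noncomputable section

namespace RingPattern

/-! ### Rotations of the sphere and frames -/

/-- The rotations of 3-space, as matrices. -/
abbrev SO3 := Matrix.specialOrthogonalGroup (Fin 3) ℝ

theorem mem_SO3_iff {M : Matrix (Fin 3) (Fin 3) ℝ} :
    M ∈ Matrix.specialOrthogonalGroup (Fin 3) ℝ ↔ M.transpose * M = 1 ∧ M.det = 1 := by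
  rw [Matrix.mem_specialOrthogonalGroup_iff, Matrix.mem_orthogonalGroup_iff']

/-- The rotation about the first axis by the angle `α`. -/
def rotZ (α : ℝ) : SO3 :=
  ⟨!![1, 0, 0; 0, Real.cos α, -Real.sin α; 0, Real.sin α, Real.cos α], by
    rw [mem_SO3_iff]
    have := Real.sin_sq_add_cos_sq α
    constructor
    · ext i j
      fin_cases i <;> fin_cases j <;> simp [Matrix.mul_apply, Fin.sum_univ_three] <;> linarith
    · simp [Matrix.det_fin_three]; linarith⟩

/-- The half turn of the frame at a point `x`, with second axis towards `y`, that carries it into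
the frame at `y`, with second axis towards `x`, where `x` and `y` have distance `d`. -/
def halfTurn (d : ℝ) : SO3 :=
  ⟨!![Real.cos d, Real.sin d, 0; Real.sin d, -Real.cos d, 0; 0, 0, -1], by
    rw [mem_SO3_iff]
    have := Real.sin_sq_add_cos_sq d
    constructor
    · ext i j
      fin_cases i <;> fin_cases j <;> simp [Matrix.mul_apply, Fin.sum_univ_three] <;> linarith
    · simp [Matrix.det_fin_three]; linarith⟩

theorem rotZ_zero : rotZ 0 = 1 := by
  ext i j
  fin_cases i <;> fin_cases j <;> simp [rotZ]

theorem rotZ_add (α β : ℝ) : rotZ (α + β) = rotZ α * rotZ β := by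
  ext i j
  fin_cases i <;> fin_cases j <;>
    simp [rotZ, Real.cos_add, Real.sin_add] <;> ring

theorem rotZ_neg (α : ℝ) : rotZ (-α) = (rotZ α)⁻¹ := by
  rw [eq_inv_iff_mul_eq_one, ← rotZ_add, neg_add_cancel, rotZ_zero]

theorem halfTurn_mul_self (d : ℝ) : halfTurn d * halfTurn d = 1 := by
  have := Real.sin_sq_add_cos_sq d
  ext i j
  fin_cases i <;> fin_cases j <;>
    simp [halfTurn] <;> linarith

theorem halfTurn_inv (d : ℝ) : (halfTurn d)⁻¹ = halfTurn d :=
  inv_eq_of_mul_eq_one_right (halfTurn_mul_self d)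

theorem continuous_rotZ : Continuous rotZ := by
  refine Continuous.subtype_mk (continuous_matrix fun i j => ?_) _
  fin_cases i <;> fin_cases j <;> simp <;> fun_prop

theorem continuous_halfTurn : Continuous halfTurn := by
  refine Continuous.subtype_mk (continuous_matrix fun i j => ?_) _
  fin_cases i <;> fin_cases j <;> simp <;> fun_prop

/-! ### Right-angled spherical triangles and kites -/

/-- The relations in a right-angled spherical triangle with legs `a`, `b`, hypotenuse `D`, and angles
`x`, `y` opposite to `b`, `a`. -/
structure RightTriangle (a b D x y : ℝ) : Prop where
  cos_hyp : Real.cos D = Real.cos a * Real.cos b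
  sin_hyp_ne : Real.sin D ≠ 0
  cos_left : Real.sin D * Real.cos x = Real.sin a * Real.cos b
  sin_left : Real.sin D * Real.sin x = Real.sin b
  cos_right : Real.sin D * Real.cos y = Real.sin b * Real.cos a
  sin_right : Real.sin D * Real.sin y = Real.sin a

theorem cos_sign_mul {s : ℝ} (hs : s = 1 ∨ s = -1) (x : ℝ) : Real.cos (s * x) = Real.cos x := by
  rcases hs with rfl | rfl <;> simp

theorem sin_sign_mul {s : ℝ} (hs : s = 1 ∨ s = -1) (x : ℝ) :
    Real.sin (s * x) = s * Real.sin x := by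
  rcases hs with rfl | rfl <;> simp

/-- Two ways from one end of the hypotenuse to the other: along the legs with a quarter turn at the
right angle, or along the hypotenuse with turns by the adjacent angles. The sign `s` distinguishes
the triangle from its mirror image. Entry by entry this is spherical trigonometry. -/
theorem RightTriangle.halfTurn_mul {a b D x y : ℝ} (h : RightTriangle a b D x y) {s : ℝ}
    (hs : s = 1 ∨ s = -1) :
    halfTurn a * rotZ (-(s * (π / 2))) * halfTurn b =
      rotZ (s * x) * halfTurn D * rotZ (s * y) := by
  obtain ⟨h1, h2, h3, h4, h5, h6⟩ := h
  have hD := Real.sin_sq_add_cos_sq D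
  have ha := Real.sin_sq_add_cos_sq a
  have hb := Real.sin_sq_add_cos_sq b
  have hss : s ^ 2 = 1 := by rcases hs with rfl | rfl <;> norm_num
  have cs := cos_sign_mul hs
  have ss := sin_sign_mul hs
  -- The three forms of sin² D are what remains to be checked once the angles have been eliminated.
  have k1 : Real.sin D ^ 2 = 1 - (Real.cos a * Real.cos b) ^ 2 := by rw [← h1]; linarith
  have k2 : Real.sin D ^ 2 = Real.sin a ^ 2 * Real.cos b ^ 2 + Real.sin b ^ 2 := by
    linear_combination k1 - Real.cos b ^ 2 * ha - hb
  have k3 : Real.sin D ^ 2 = Real.sin b ^ 2 * Real.cos a ^ 2 + Real.sin a ^ 2 := by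
    linear_combination k1 - Real.cos a ^ 2 * hb - ha
  have e3 : Real.cos x = Real.sin a * Real.cos b / Real.sin D := by field_simp; linarith
  have e4 : Real.sin x = Real.sin b / Real.sin D := by field_simp; linarith
  have e5 : Real.cos y = Real.sin b * Real.cos a / Real.sin D := by field_simp; linarith
  have e6 : Real.sin y = Real.sin a / Real.sin D := by field_simp; linarith
  clear h3 h4 h5 h6
  ext i j
  fin_cases i <;> fin_cases j <;>
    simp [rotZ, halfTurn, cs, ss, e3, e4, e5, e6, h1] <;> field_simp
  · linear_combination Real.sin a * Real.sin b * (k1 - hss)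
  · linear_combination Real.cos a * s * k2
  · linear_combination -Real.cos b * s * k3
  · linear_combination -Real.sin b * Real.sin a * Real.cos a * Real.cos b * hss

theorem sin_pos_of_acute {a : ℝ} (ha : a ∈ Set.Ioo 0 (π / 2)) : 0 < Real.sin a :=
  Real.sin_pos_of_pos_of_lt_pi ha.1 (by linarith [ha.2, Real.pi_pos])

theorem cos_pos_of_acute {a : ℝ} (ha : a ∈ Set.Ioo 0 (π / 2)) : 0 < Real.cos a :=
  Real.cos_pos_of_mem_Ioo ⟨by linarith [ha.1, Real.pi_pos], ha.2⟩

/-- The angle at a vertex in the triangle with adjacent leg `a` and opposite leg `b`. -/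
def legAngle (a b : ℝ) : ℝ := Real.arctan (Real.tan b / Real.sin a)

theorem legAngle_mem {a b : ℝ} (ha : a ∈ Set.Ioo 0 (π / 2)) (hb : b ∈ Set.Ioo 0 (π / 2)) :
    legAngle a b ∈ Set.Ioo 0 (π / 2) :=
  ⟨Real.arctan_pos.2 (div_pos (Real.tan_pos_of_pos_of_lt_pi_div_two hb.1 hb.2)
    (sin_pos_of_acute ha)), Real.arctan_lt_pi_div_two _⟩

/-- Napier's rule tan x = tan b / sin a defines `legAngle`. The condition sin D > 0 selects the
square root in the formulas for cos and sin of an arctangent. -/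
theorem cos_sin_legAngle {a b D : ℝ} (ha : a ∈ Set.Ioo 0 (π / 2)) (hb : b ∈ Set.Ioo 0 (π / 2))
    (hD : Real.cos D = Real.cos a * Real.cos b) (hD0 : 0 < Real.sin D) :
    Real.sin D * Real.cos (legAngle a b) = Real.sin a * Real.cos b ∧
      Real.sin D * Real.sin (legAngle a b) = Real.sin b := by
  have sa := sin_pos_of_acute ha
  have sb := sin_pos_of_acute hb
  have cb := cos_pos_of_acute hb
  have h1 := Real.sin_sq_add_cos_sq D
  have h2 := Real.sin_sq_add_cos_sq a
  have h3 := Real.sin_sq_add_cos_sq b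
  rw [hD] at h1
  have key : √(1 + (Real.tan b / Real.sin a) ^ 2) = Real.sin D / (Real.sin a * Real.cos b) := by
    rw [Real.sqrt_eq_iff_mul_self_eq (by positivity) (by positivity), Real.tan_eq_sin_div_cos]
    field_simp
    linear_combination Real.cos b ^ 2 * h2 + h3 - h1
  rw [legAngle, Real.cos_arctan, Real.sin_arctan, key, Real.tan_eq_sin_div_cos]
  constructor <;> field_simp

theorem rightTriangle {a b : ℝ} (ha : a ∈ Set.Ioo 0 (π / 2)) (hb : b ∈ Set.Ioo 0 (π / 2)) :
    RightTriangle a b (Real.arccos (Real.cos a * Real.cos b)) (legAngle a b) (legAngle b a) := by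
  have sa := sin_pos_of_acute ha
  have ca := cos_pos_of_acute ha
  have cb := cos_pos_of_acute hb
  have h2 := Real.sin_sq_add_cos_sq a
  have lt : Real.cos a * Real.cos b < 1 := by
    have : Real.cos a < 1 := by nlinarith
    nlinarith [Real.cos_le_one b]
  have hD : Real.cos (Real.arccos (Real.cos a * Real.cos b)) = Real.cos a * Real.cos b :=
    Real.cos_arccos (by nlinarith) lt.le
  have hD0 : 0 < Real.sin (Real.arccos (Real.cos a * Real.cos b)) := by
    rw [Real.sin_arccos]
    apply Real.sqrt_pos.2
    nlinarith [mul_pos ca cb]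
  obtain ⟨h3, h4⟩ := cos_sin_legAngle ha hb hD hD0
  obtain ⟨h5, h6⟩ := cos_sin_legAngle hb ha (by rw [hD, mul_comm]) hD0
  exact ⟨hD, hD0.ne', h3, h4, h5, h6⟩

/-- The angle at the centre of the ring with radii `r`, `R` in the quadrilateral that it spans with
an orthogonally intersecting ring with radii `r'`, `R'`. -/
def kiteAngle (r R r' R' : ℝ) : ℝ := legAngle r R' + legAngle R r'

theorem kiteAngle_mem {r R r' R' : ℝ} (hr : r ∈ Set.Ioo 0 (π / 2)) (hR : R ∈ Set.Ioo 0 (π / 2))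
    (hr' : r' ∈ Set.Ioo 0 (π / 2)) (hR' : R' ∈ Set.Ioo 0 (π / 2)) :
    kiteAngle r R r' R' ∈ Set.Ioo 0 π := by
  have h1 := legAngle_mem hr hR'
  have h2 := legAngle_mem hR hr'
  exact ⟨add_pos h1.1 h2.1, by unfold kiteAngle; linarith [h1.2, h2.2]⟩

/-- The quadrilateral with two right angles spanned by two orthogonal rings closes. -/
theorem kite_closes {r R r' R' : ℝ} (hr : r ∈ Set.Ioo 0 (π / 2)) (hR : R ∈ Set.Ioo 0 (π / 2))
    (hr' : r' ∈ Set.Ioo 0 (π / 2)) (hR' : R' ∈ Set.Ioo 0 (π / 2))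
    (h : Real.cos r * Real.cos R' = Real.cos R * Real.cos r') {s : ℝ} (hs : s = 1 ∨ s = -1) :
    halfTurn r * rotZ (-(s * (π / 2))) * halfTurn R' * rotZ (-(s * kiteAngle r' R' r R)) =
      rotZ (s * kiteAngle r R r' R') * halfTurn R * rotZ (s * (π / 2)) * halfTurn r' := by
  have t1 := (rightTriangle hr hR').halfTurn_mul hs
  have hs' : -s = 1 ∨ -s = -1 := by rcases hs with rfl | rfl <;> simp
  have t2 := (rightTriangle hR hr').halfTurn_mul hs'
  -- The two triangles lie on opposite sides of their common hypotenuse, hence the sign -s in `t2`;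
  -- the hypothesis `h` identifies the hypotenuses.
  rw [← h, neg_mul, neg_neg, mul_assoc] at t2
  rw [t1, mul_assoc (_ * _) (rotZ _) (halfTurn r'), mul_assoc (rotZ _) (halfTurn R), t2]
  simp only [mul_assoc, ← rotZ_add]
  simp only [← mul_assoc, ← rotZ_add]
  simp only [kiteAngle]
  congr 2
  · congr 2; ring
  · ring

/-! ### Frames as points with a tangent direction -/

/-- The base point of a frame. -/
def basePoint (g : SO3) : S2 :=
  ⟨WithLp.toLp 2 fun i => g.1 i 0, by
    have h := congrFun (congrFun (mem_SO3_iff.1 g.2).1 0) 0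
    simp [Matrix.mul_apply, Fin.sum_univ_three] at h
    simp [EuclideanSpace.norm_eq, Fin.sum_univ_three, pow_two, h]⟩

/-- The action of the rotations on the sphere. -/
def rotate (g : SO3) (x : S2) : S2 :=
  ⟨WithLp.toLp 2 (g.1.mulVec x.1.ofLp), by
    have hx := x.2
    rw [mem_sphere_zero_iff_norm] at hx ⊢
    rw [← sq_eq_sq₀ (norm_nonneg _) (by norm_num), ← real_inner_self_eq_norm_sq] at hx ⊢
    rw [← hx]
    simp only [EuclideanSpace.inner_eq_star_dotProduct, star_trivial]
    rw [Matrix.dotProduct_mulVec, Matrix.vecMul_mulVec, (mem_SO3_iff.1 g.2).1, Matrix.vecMul_one]⟩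

theorem rotate_one (x : S2) : rotate 1 x = x := by
  ext i
  simp [rotate]

theorem rotate_basePoint (g h : SO3) : rotate g (basePoint h) = basePoint (g * h) := by
  ext i
  simp [rotate, basePoint, Matrix.mul_apply, Matrix.mulVec, dotProduct]

theorem basePoint_mul_rotZ (g : SO3) (α : ℝ) : basePoint (g * rotZ α) = basePoint g := by
  ext i
  simp [basePoint, rotZ, Matrix.mul_apply, Fin.sum_univ_three]

theorem continuous_rotate_left (x : S2) : Continuous fun g : SO3 => rotate g x := by
  refine Continuous.subtype_mk ?_ _
  fun_prop

theorem inner_rotate (g : SO3) (x y : S2) :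
    ⟪(rotate g x : EuclideanSpace ℝ (Fin 3)), (rotate g y : EuclideanSpace ℝ (Fin 3))⟫_ℝ =
      ⟪(x : EuclideanSpace ℝ (Fin 3)), (y : EuclideanSpace ℝ (Fin 3))⟫_ℝ := by
  simp only [EuclideanSpace.inner_eq_star_dotProduct, star_trivial, rotate]
  rw [Matrix.dotProduct_mulVec, Matrix.vecMul_mulVec, (mem_SO3_iff.1 g.2).1, Matrix.vecMul_one]

theorem det3_rotate (g : SO3) (x y z : S2) :
    det3 (rotate g x) (rotate g y) (rotate g z) = det3 x y z := by
  have : Matrix.of ![(rotate g x).1.ofLp, (rotate g y).1.ofLp, (rotate g z).1.ofLp] =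
      Matrix.of ![x.1.ofLp, y.1.ofLp, z.1.ofLp] * g.1.transpose := by
    ext i j
    fin_cases i <;>
      simp [rotate, Matrix.mul_apply, Matrix.mulVec, dotProduct, mul_comm]
  rw [det3, det3, this, Matrix.det_mul, Matrix.det_transpose, (mem_SO3_iff.1 g.2).2, mul_one]

theorem inner_tangentPart (x y z : S2) :
    ⟪tangentPart x y, tangentPart x z⟫_ℝ =
      ⟪(y : EuclideanSpace ℝ (Fin 3)), (z : EuclideanSpace ℝ (Fin 3))⟫_ℝ -
      ⟪(x : EuclideanSpace ℝ (Fin 3)), (y : EuclideanSpace ℝ (Fin 3))⟫_ℝ *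
      ⟪(x : EuclideanSpace ℝ (Fin 3)), (z : EuclideanSpace ℝ (Fin 3))⟫_ℝ := by
  have hx : ⟪(x : EuclideanSpace ℝ (Fin 3)), (x : EuclideanSpace ℝ (Fin 3))⟫_ℝ = 1 := by
    rw [real_inner_self_eq_norm_sq, mem_sphere_zero_iff_norm.1 x.2]; norm_num
  simp only [tangentPart, inner_sub_left, inner_sub_right, real_inner_smul_left,
    real_inner_smul_right, hx]
  rw [real_inner_comm (y : EuclideanSpace ℝ (Fin 3)) x]
  ring

theorem angle_eq_iff (x y : S2) {d : ℝ} (h0 : 0 ≤ d) (h1 : d ≤ π) :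
    InnerProductGeometry.angle (x : EuclideanSpace ℝ (Fin 3)) y = d ↔
      ⟪(x : EuclideanSpace ℝ (Fin 3)), (y : EuclideanSpace ℝ (Fin 3))⟫_ℝ = Real.cos d := by
  have hc := InnerProductGeometry.cos_angle (x : EuclideanSpace ℝ (Fin 3)) y
  rw [mem_sphere_zero_iff_norm.1 x.2, mem_sphere_zero_iff_norm.1 y.2, mul_one, div_one] at hc
  rw [← hc]
  exact ⟨fun h => by rw [h], fun h => Real.injOn_cos ⟨InnerProductGeometry.angle_nonneg _ _,
    InnerProductGeometry.angle_le_pi _ _⟩ ⟨h0, h1⟩ h⟩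

/-- The frame `g` sits at `x`, its second axis points towards `y`, and `y` has distance `d`. -/
def IsFrame (g : SO3) (x y : S2) (d : ℝ) : Prop :=
  basePoint g = x ∧ basePoint (g * halfTurn d) = y

theorem IsFrame.symm {g : SO3} {x y : S2} {d : ℝ} (h : IsFrame g x y d) :
    IsFrame (g * halfTurn d) y x d :=
  ⟨h.2, by rw [mul_assoc, halfTurn_mul_self, mul_one, h.1]⟩

theorem IsFrame.inner_eq {g : SO3} {x y : S2} {d : ℝ} (h : IsFrame g x y d) :
    ⟪(x : EuclideanSpace ℝ (Fin 3)), (y : EuclideanSpace ℝ (Fin 3))⟫_ℝ = Real.cos d := by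
  obtain ⟨rfl, rfl⟩ := h
  have e : basePoint g = rotate g (basePoint 1) := by rw [rotate_basePoint, mul_one]
  rw [e, ← rotate_basePoint, inner_rotate]
  simp [basePoint, halfTurn, EuclideanSpace.inner_eq_star_dotProduct, dotProduct,
    Fin.sum_univ_three]

/-- By invariance under rotations the computation takes place in the standard frame. Together with
the determinant below it shows that the parameter of `rotZ` is the oriented angle between two
directions. -/
theorem IsFrame.inner_tangentPart {g : SO3} {x y z : S2} {d d' α : ℝ} (h : IsFrame g x y d)
    (h' : IsFrame (g * rotZ α) x z d') :
    ⟪tangentPart x y, tangentPart x z⟫_ℝ = Real.sin d * Real.sin d' * Real.cos α := by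
  rw [RingPattern.inner_tangentPart, h.inner_eq, h'.inner_eq]
  obtain ⟨rfl, rfl⟩ := h
  obtain ⟨-, rfl⟩ := h'
  rw [mul_assoc, ← rotate_basePoint, ← rotate_basePoint, inner_rotate]
  simp [basePoint, halfTurn, rotZ, EuclideanSpace.inner_eq_star_dotProduct, dotProduct,
    Fin.sum_univ_three]
  ring

theorem IsFrame.det3_eq {g : SO3} {x y z : S2} {d d' α : ℝ} (h : IsFrame g x y d)
    (h' : IsFrame (g * rotZ α) x z d') :
    det3 x y z = Real.sin d * Real.sin d' * Real.sin α := by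
  obtain ⟨rfl, rfl⟩ := h
  obtain ⟨-, rfl⟩ := h'
  have e : basePoint g = rotate g (basePoint 1) := by rw [rotate_basePoint, mul_one]
  rw [e, mul_assoc, ← rotate_basePoint, ← rotate_basePoint, det3_rotate]
  simp [det3, basePoint, halfTurn, rotZ, Matrix.det_fin_three]
  ring

theorem IsFrame.orientedAngle_eq {g : SO3} {x y z : S2} {d d' α : ℝ} (h : IsFrame g x y d)
    (h' : IsFrame (g * rotZ α) x z d') (hd : 0 < Real.sin d) (hd' : 0 < Real.sin d')
    (hα : α ∈ Set.Ioc (-π) π) : orientedAngle x y z = α := by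
  rw [orientedAngle, h.inner_tangentPart h', h.det3_eq h']
  convert Complex.arg_mul_cos_add_sin_mul_I (mul_pos hd hd') hα using 2
  apply Complex.ext <;> simp [← Complex.ofReal_sin, ← Complex.ofReal_cos]

theorem exists_frame {x y : S2} {d : ℝ} (hd : Real.sin d ≠ 0)
    (h : ⟪(x : EuclideanSpace ℝ (Fin 3)), (y : EuclideanSpace ℝ (Fin 3))⟫_ℝ = Real.cos d) :
    ∃ g, IsFrame g x y d := by
  have hx := x.2
  have hy := y.2
  rw [mem_sphere_zero_iff_norm, ← sq_eq_sq₀ (norm_nonneg _) (by norm_num),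
    ← real_inner_self_eq_norm_sq] at hx hy
  have hs := Real.sin_sq_add_cos_sq d
  simp only [EuclideanSpace.inner_eq_star_dotProduct, dotProduct, Fin.sum_univ_three, star_trivial]
    at hx hy h
  obtain ⟨x, _⟩ := x
  obtain ⟨y, _⟩ := y
  simp only at hx hy h
  -- The unit tangent vector at x towards y; the frame is x, u, x × u.
  obtain ⟨u, hu⟩ : ∃ u : Fin 3 → ℝ, ∀ i, y i = Real.cos d * x i + Real.sin d * u i :=
    ⟨fun i => (y i - Real.cos d * x i) / Real.sin d, fun i => by field_simp; ring⟩
  simp only [hu] at hy h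
  have hxu : x 0 * u 0 + x 1 * u 1 + x 2 * u 2 = 0 := by
    apply mul_left_cancel₀ hd
    linear_combination h - Real.cos d * hx
  have huu : u 0 * u 0 + u 1 * u 1 + u 2 * u 2 = 1 := by
    apply mul_left_cancel₀ (pow_ne_zero 2 hd)
    linear_combination hy - Real.cos d ^ 2 * hx - 2 * Real.cos d * Real.sin d * hxu - hs
  refine ⟨⟨!![x 0, u 0, x 1 * u 2 - x 2 * u 1; x 1, u 1, x 2 * u 0 - x 0 * u 2;
    x 2, u 2, x 0 * u 1 - x 1 * u 0], mem_SO3_iff.2 ⟨?_, ?_⟩⟩, ?_, ?_⟩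
  · ext i j
    fin_cases i <;> fin_cases j <;>
      simp [Matrix.mul_apply, Fin.sum_univ_three] <;> try ring1
    · linear_combination hx
    · linear_combination hxu
    · linear_combination hxu
    · linear_combination huu
    · linear_combination (u 0 * u 0 + u 1 * u 1 + u 2 * u 2) * hx + huu -
        (x 0 * u 0 + x 1 * u 1 + x 2 * u 2) * hxu
  · simp [Matrix.det_fin_three]
    linear_combination (u 0 * u 0 + u 1 * u 1 + u 2 * u 2) * hx + huu -
      (x 0 * u 0 + x 1 * u 1 + x 2 * u 2) * hxu
  · ext i
    fin_cases i <;> simp [basePoint]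
  · ext i
    fin_cases i <;> simp [basePoint, halfTurn, hu] <;> ring

/-- The stabilizer of the base point is the circle group of the `rotZ`. -/
theorem exists_eq_mul_rotZ {g h : SO3} (e : basePoint g = basePoint h) :
    ∃ α ∈ Set.Ioc (-π) π, h = g * rotZ α := by
  obtain ⟨k, rfl⟩ : ∃ k, h = g * k := ⟨g⁻¹ * h, by simp⟩
  have e' : basePoint 1 = basePoint k := by
    have := congrArg (rotate g⁻¹) e
    simpa [rotate_basePoint] using this
  obtain ⟨k, hk⟩ := k
  have c : ∀ i, k i 0 = (1 : Matrix (Fin 3) (Fin 3) ℝ) i 0 := fun i => by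
    have := congrArg (fun x : S2 => x.1.ofLp i) e'
    simpa [basePoint] using this.symm
  obtain ⟨h1, h2⟩ := mem_SO3_iff.1 hk
  have o : ∀ i j, k 0 i * k 0 j + k 1 i * k 1 j + k 2 i * k 2 j =
      (1 : Matrix (Fin 3) (Fin 3) ℝ) i j := fun i j => by
    rw [← h1]; simp [Matrix.mul_apply, Fin.sum_univ_three]
  have c0 := c 0
  have c1 := c 1
  have c2 := c 2
  have o01 := o 0 1
  have o02 := o 0 2
  have o11 := o 1 1
  have o12 := o 1 2
  rw [Matrix.det_fin_three] at h2
  simp at c0 c1 c2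
  simp [c0, c1, c2] at o01 o02 h2
  simp [o01, o02] at o11 o12
  -- The lower right block is orthogonal with determinant 1, so its second column is the first one
  -- turned by a right angle.
  have k12 : k 1 2 = -k 2 1 := by
    linear_combination -k 1 2 * o11 + k 1 1 * o12 - k 2 1 * h2
  have k22 : k 2 2 = k 1 1 := by
    linear_combination -k 2 2 * o11 + k 2 1 * o12 + k 1 1 * h2
  have hn : ‖(⟨k 1 1, k 2 1⟩ : ℂ)‖ = 1 := by
    rw [Complex.norm_def, Complex.normSq_mk, o11, Real.sqrt_one]
  have hne : (⟨k 1 1, k 2 1⟩ : ℂ) ≠ 0 := by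
    rw [← norm_ne_zero_iff, hn]; exact one_ne_zero
  refine ⟨Complex.arg ⟨k 1 1, k 2 1⟩, Complex.arg_mem_Ioc _, ?_⟩
  congr 1
  ext i j
  fin_cases i <;> fin_cases j <;>
    simp [rotZ, Complex.cos_arg hne, Complex.sin_arg, hn, c0, c1, c2, o01, o02, k12, k22]

/-- A direction towards a point that is neither equal nor antipodal to the base point determines the
frame. -/
theorem IsFrame.unique {g h : SO3} {x y : S2} {d : ℝ} (hd : Real.sin d ≠ 0) (hg : IsFrame g x y d)
    (hh : IsFrame h x y d) : g = h := by
  obtain ⟨α, -, rfl⟩ := exists_eq_mul_rotZ (hg.1.trans hh.1.symm)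
  have e : basePoint (halfTurn d) = basePoint (rotZ α * halfTurn d) := by
    have := congrArg (rotate g⁻¹) (hg.2.trans hh.2.symm)
    simpa [rotate_basePoint, mul_assoc] using this
  have e1 := congrArg (fun x : S2 => x.1.ofLp 1) e
  have e2 := congrArg (fun x : S2 => x.1.ofLp 2) e
  simp [basePoint, halfTurn, rotZ] at e1 e2
  have e1' : Real.cos α = 1 := by
    apply mul_right_cancel₀ hd; linarith
  have e2' : Real.sin α = 0 := by tauto
  have : rotZ α = 1 := by
    ext i j
    fin_cases i <;> fin_cases j <;> simp [rotZ, e1', e2']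
  rw [this, mul_one]

/-! ### Rigidity of the kites of a circle pattern -/

/-- The angles of a decomposition of a rotation are unique up to multiples of `2π`. -/
theorem rotZ_halfTurn_rotZ_inj {α β α' β' d : ℝ} (hd : Real.sin d ≠ 0)
    (h : rotZ α * halfTurn d * rotZ β = rotZ α' * halfTurn d * rotZ β') :
    Real.cos α = Real.cos α' ∧ Real.sin α = Real.sin α' := by
  have e (i : Fin 3) := congrArg (fun g : SO3 => g.1 i 0) h
  have e1 := e 1
  have e2 := e 2
  simp [rotZ, halfTurn] at e1 e2
  tauto

theorem eq_of_cos_sin_eq {x y : ℝ} (hc : Real.cos x = Real.cos y) (hs : Real.sin x = Real.sin y)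
    (h : |x - y| < 2 * π) : x = y := by
  obtain ⟨k, hk⟩ := Real.Angle.angle_eq_iff_two_pi_dvd_sub.1 (Real.Angle.cos_sin_inj hc hs)
  have hpi := Real.two_pi_pos
  rw [hk, abs_mul, abs_of_pos hpi, mul_lt_iff_lt_one_right hpi] at h
  have : k = 0 := by
    rw [← Int.abs_lt_one_iff]
    exact_mod_cast h
  rw [this, Int.cast_zero, mul_zero] at hk
  linarith

theorem eq_sign_mul_of_cos_eq_zero {α : ℝ} (hα : α ∈ Set.Ioc (-π) π) (h : Real.cos α = 0) :
    ∃ σ : ℝ, (σ = 1 ∨ σ = -1) ∧ α = σ * (π / 2) := by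
  have hs : Real.sin α = 1 ∨ Real.sin α = -1 := by
    have := Real.sin_sq_add_cos_sq α
    rw [h] at this
    exact mul_self_eq_one_iff.1 (by linarith [sq (Real.sin α)])
  have hpi := Real.pi_pos
  rcases hs with hs | hs
  · refine ⟨1, .inl rfl, ?_⟩
    rw [one_mul]
    refine eq_of_cos_sin_eq (by simpa using h) (by simpa using hs) ?_
    rw [abs_lt]; constructor <;> linarith [hα.1, hα.2]
  · refine ⟨-1, .inr rfl, ?_⟩
    rw [neg_one_mul]
    refine eq_of_cos_sin_eq (by simpa using h) (by simpa using hs) ?_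
    rw [abs_lt]; constructor <;> linarith [hα.1, hα.2]

theorem orthogonalAt_iff {g h : SO3} {x y z : S2} {d d' : ℝ} (hg : IsFrame g x y d)
    (hh : IsFrame h x z d') (hd : Real.sin d ≠ 0) (hd' : Real.sin d' ≠ 0) :
    OrthogonalAt x y z ↔ ∃ σ : ℝ, (σ = 1 ∨ σ = -1) ∧ h = g * rotZ (σ * (π / 2)) := by
  constructor
  · intro ho
    obtain ⟨α, hα, rfl⟩ := exists_eq_mul_rotZ (hg.1.trans hh.1.symm)
    rw [OrthogonalAt, hg.inner_tangentPart hh] at ho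
    obtain ⟨σ, hσ, rfl⟩ := eq_sign_mul_of_cos_eq_zero hα (by simpa [hd, hd'] using ho)
    exact ⟨σ, hσ, rfl⟩
  · rintro ⟨σ, hσ, rfl⟩
    rw [OrthogonalAt, hg.inner_tangentPart hh, cos_sign_mul hσ]
    simp

/-- Orthogonality leaves the senses σ, τ of the two right angles open. Going from v to w through l
and through l' uses congruent triangles with angle x = `legAngle R R'` at v, and comparing the two
results gives s φ = (σ + τ) x modulo 2π. Since 0 < φ < π and 0 < x < π/2, only σ = τ = s remains,
with φ = 2x. -/
theorem kite_rigid_aux {v w l l' : S2} {R R' s φ ψ : ℝ} {gv gv' gw gw' : SO3}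
    (hR : R ∈ Set.Ioo 0 (π / 2)) (hR' : R' ∈ Set.Ioo 0 (π / 2)) (hs : s = 1 ∨ s = -1)
    (hv : IsFrame gv v l R) (hv' : IsFrame gv' v l' R) (hw : IsFrame gw w l R')
    (hw' : IsFrame gw' w l' R') (ho : OrthogonalAt l v w) (ho' : OrthogonalAt l' w v)
    (eφ : gv' = gv * rotZ (s * φ)) (hφ : φ ∈ Set.Ioo 0 π) (eψ : gw = gw' * rotZ (s * ψ)) :
    φ = kiteAngle R R R' R' ∧ gv * halfTurn R = gw * halfTurn R' * rotZ (s * (π / 2)) := by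
  have sR := (sin_pos_of_acute hR).ne'
  have sR' := (sin_pos_of_acute hR').ne'
  have sym : OrthogonalAt l w v := by rw [OrthogonalAt, real_inner_comm]; exact ho
  have sym' : OrthogonalAt l' v w := by rw [OrthogonalAt, real_inner_comm]; exact ho'
  obtain ⟨σ, hσ, e1⟩ := (orthogonalAt_iff hw.symm hv.symm sR' sR).1 sym
  obtain ⟨τ, hτ, e2⟩ := (orthogonalAt_iff hv'.symm hw'.symm sR sR').1 sym'
  have hτ' : -τ = 1 ∨ -τ = -1 := by rcases hτ with rfl | rfl <;> simp
  have e3 : gw = gv * (halfTurn R * rotZ (-(σ * (π / 2))) * halfTurn R') := by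
    have : gw = gv * halfTurn R * (rotZ (σ * (π / 2)))⁻¹ * (halfTurn R')⁻¹ := by rw [e1]; group
    rw [this, rotZ_neg, halfTurn_inv]; group
  -- The double negation brings the turn at l' into the form required by
  -- `RightTriangle.halfTurn_mul` with sign -τ.
  have e4 : gw = gv * (rotZ (s * φ) * (halfTurn R * rotZ (-(-τ * (π / 2))) * halfTurn R') *
      rotZ (s * ψ)) := by
    have : gw' = gv' * halfTurn R * rotZ (τ * (π / 2)) * (halfTurn R')⁻¹ := by rw [← e2]; group
    rw [eψ, this, eφ, halfTurn_inv, neg_mul, neg_neg]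
    simp only [mul_assoc]
  have t := rightTriangle hR hR'
  have e5 := mul_left_cancel (e3.symm.trans e4)
  rw [t.halfTurn_mul hσ, t.halfTurn_mul hτ'] at e5
  simp only [← mul_assoc, ← rotZ_add] at e5
  rw [mul_assoc _ (rotZ _) (rotZ (s * ψ)), ← rotZ_add] at e5
  obtain ⟨hc, hsn⟩ := rotZ_halfTurn_rotZ_inj t.sin_hyp_ne e5
  have hx := legAngle_mem hR hR'
  -- All angles are small enough to exclude a nonzero multiple of 2π.
  have e6 := eq_of_cos_sin_eq hc hsn (by
    rw [abs_lt]
    rcases hs with rfl | rfl <;> rcases hσ with rfl | rfl <;> rcases hτ with rfl | rfl <;>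
      constructor <;> linarith [hx.1, hx.2, hφ.1, hφ.2])
  have e7 : φ = 2 * legAngle R R' ∧ σ = s := by
    rcases hs with rfl | rfl <;> rcases hσ with rfl | rfl <;> rcases hτ with rfl | rfl <;>
      first
      | exact ⟨by linarith, rfl⟩
      | linarith [hx.1, hx.2, hφ.1, hφ.2]
  rw [← e7.2]
  exact ⟨by rw [kiteAngle]; linarith, e1⟩

/-- In the quadrilateral spanned by two orthogonal circles of positive orientation the angles at the
centres are determined by the radii, and the other two angles are right angles. -/
theorem kite_rigid {v w l l' : S2} {R R' s φ ψ : ℝ} {gv gv' gw gw' : SO3}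
    (hR : R ∈ Set.Ioo 0 (π / 2)) (hR' : R' ∈ Set.Ioo 0 (π / 2)) (hs : s = 1 ∨ s = -1)
    (hv : IsFrame gv v l R) (hv' : IsFrame gv' v l' R) (hw : IsFrame gw w l R')
    (hw' : IsFrame gw' w l' R') (ho : OrthogonalAt l v w) (ho' : OrthogonalAt l' w v)
    (eφ : gv' = gv * rotZ (s * φ)) (hφ : φ ∈ Set.Ioo 0 π)
    (eψ : gw = gw' * rotZ (s * ψ)) (hψ : ψ ∈ Set.Ioo 0 π) :
    φ = kiteAngle R R R' R' ∧ ψ = kiteAngle R' R' R R ∧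
      gv * halfTurn R = gw * halfTurn R' * rotZ (s * (π / 2)) ∧
      gw' * halfTurn R' = gv' * halfTurn R * rotZ (s * (π / 2)) := by
  obtain ⟨h1, h2⟩ := kite_rigid_aux hR hR' hs hv hv' hw hw' ho ho' eφ hφ eψ
  obtain ⟨h3, h4⟩ := kite_rigid_aux hR' hR hs hw' hw hv' hv ho' ho eψ hψ eφ
  exact ⟨h1, h3, h2, h4⟩

/-! ### Holonomy -/

section Holonomy

variable {G : Type*} [Group G]

/-- The product of the transports `T` along an edge path. -/
def holonomy {Q : SquareComplex} (T : ℤ × ℤ → ℤ × ℤ → G) :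
    ∀ {u v : ℤ × ℤ}, (edgeGraph Q).Walk u v → G
  | _, _, .nil => 1
  | u, _, .cons (v := v) _ p => T u v * holonomy T p

/-- The transport `T` along the edges of the complex is flat. -/
structure IsFlat (Q : SquareComplex) (T : ℤ × ℤ → ℤ × ℤ → G) : Prop where
  mul_eq_one : ∀ u v, (edgeGraph Q).Adj u v → T u v * T v u = 1
  square : ∀ s ∈ Q, ∀ a ∈ corners s, ∀ b ∈ corners s, ∀ c ∈ corners s, ∀ d ∈ corners s,
    (edgeGraph Q).Adj a b → (edgeGraph Q).Adj b c → (edgeGraph Q).Adj a d →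
    (edgeGraph Q).Adj d c → T a b * T b c = T a d * T d c

/-- Each generator of edge homotopy is matched by one of the two flatness conditions. -/
theorem IsFlat.holonomy_eq {Q : SquareComplex} {T : ℤ × ℤ → ℤ × ℤ → G} (hT : IsFlat Q T)
    {u v : ℤ × ℤ} {p p' : (edgeGraph Q).Walk u v} (h : EdgeHomotopic Q p p') :
    holonomy T p = holonomy T p' := by
  induction h with
  | refl => rfl
  | symm _ ih => exact ih.symm
  | trans _ _ ih ih' => exact ih.trans ih'
  | cons h _ ih => simp only [holonomy, ih]
  | backtrack h h' p => simp only [holonomy]; rw [← mul_assoc, hT.mul_eq_one _ _ h, one_mul]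
  | square hs ha hb hc hd hab hbc had hdc p =>
    simp only [holonomy]
    rw [← mul_assoc, ← mul_assoc, hT.square _ hs _ ha _ hb _ hc _ hd hab hbc had hdc]

theorem holonomy_append {Q : SquareComplex} (T : ℤ × ℤ → ℤ × ℤ → G) {u v w : ℤ × ℤ}
    (p : (edgeGraph Q).Walk u v) (p' : (edgeGraph Q).Walk v w) :
    holonomy T (p.append p') = holonomy T p * holonomy T p' := by
  induction p with
  | nil => simp [holonomy]
  | cons h p ih => simp [holonomy, ih, mul_assoc]

theorem IsFlat.holonomy_reverse {Q : SquareComplex} {T : ℤ × ℤ → ℤ × ℤ → G} (hT : IsFlat Q T)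
    {u v : ℤ × ℤ} (p : (edgeGraph Q).Walk u v) :
    holonomy T p.reverse = (holonomy T p)⁻¹ := by
  induction p with
  | nil => simp [holonomy]
  | cons h p ih =>
    rw [SimpleGraph.Walk.reverse_cons, holonomy_append, ih]
    simp only [holonomy, mul_one, mul_inv_rev]
    rw [inv_eq_of_mul_eq_one_right (hT.mul_eq_one _ _ h)]

theorem holonomy_eq_one {Q : SquareComplex} {T : ℤ × ℤ → ℤ × ℤ → G}
    (h : ∀ u v, (edgeGraph Q).Adj u v → T u v = 1) {u v : ℤ × ℤ} (p : (edgeGraph Q).Walk u v) :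
    holonomy T p = 1 := by
  induction p with
  | nil => rfl
  | cons e p ih => rw [holonomy, ih, h _ _ e, mul_one]

theorem continuousOn_holonomy {Q : SquareComplex} [TopologicalSpace G] [ContinuousMul G]
    {T : ℝ → ℤ × ℤ → ℤ × ℤ → G} {I : Set ℝ}
    (hc : ∀ u v, (edgeGraph Q).Adj u v → ContinuousOn (fun ε => T ε u v) I)
    {u v : ℤ × ℤ} (p : (edgeGraph Q).Walk u v) :
    ContinuousOn (fun ε => holonomy (T ε) p) I := by
  induction p with
  | nil => exact continuousOn_const
  | cons e p ih => exact (hc _ _ e).mul ih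

theorem mem_vertices_of_adj {Q : SquareComplex} {u v : ℤ × ℤ} (h : (edgeGraph Q).Adj u v) :
    u ∈ vertices Q := by
  obtain ⟨-, s, hs, hu, -⟩ := h
  exact Finset.mem_biUnion.2 ⟨s, hs, hu⟩

/-- A continuous family of flat transports on a simply connected complex comes from a continuous
family of functions on the vertices. -/
theorem exists_potential {Q : SquareComplex} (hQ : SimplyConnected Q) [TopologicalSpace G]
    [ContinuousMul G] (T : ℝ → ℤ × ℤ → ℤ × ℤ → G) (I : Set ℝ)
    (hT : ∀ ε ∈ I, IsFlat Q (T ε))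
    (hc : ∀ u v, (edgeGraph Q).Adj u v → ContinuousOn (fun ε => T ε u v) I)
    (h0 : ∀ u v, (edgeGraph Q).Adj u v → T 0 u v = 1) :
    ∃ A : ℝ → ℤ × ℤ → G, (∀ v, A 0 v = 1) ∧
      (∀ v, ContinuousOn (fun ε => A ε v) I) ∧
      ∀ ε ∈ I, ∀ u v, (edgeGraph Q).Adj u v → A ε v = A ε u * T ε u v := by
  rcases (vertices Q).eq_empty_or_nonempty with he | ⟨o, ho⟩
  · exact ⟨fun _ _ => 1, fun _ => rfl, fun _ => continuousOn_const, fun ε _ u v h => by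
      have := mem_vertices_of_adj h
      simp [he] at this⟩
  have hp : ∀ v, ∃ p : Option ((edgeGraph Q).Walk o v), v ∈ vertices Q → p.isSome := fun v => by
    by_cases hv : v ∈ vertices Q
    · obtain ⟨p⟩ := hQ.1 o ho v hv
      exact ⟨some p, fun _ => rfl⟩
    · exact ⟨none, fun h => absurd h hv⟩
  choose p hp using hp
  -- The paths from the base vertex are chosen independently of ε, so continuity passes to the
  -- finite products. Vertices outside the complex get the value 1.
  refine ⟨fun ε v => (p v).elim 1 (holonomy (T ε)), fun v => ?_, fun v => ?_, ?_⟩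
  · cases hq : p v with
    | none => simp only [hq, Option.elim]
    | some q => simpa only [hq, Option.elim] using holonomy_eq_one h0 q
  · cases hq : p v with
    | none => simpa only [hq, Option.elim] using continuousOn_const
    | some q => simpa only [hq, Option.elim] using continuousOn_holonomy hc q
  · intro ε hε u v h
    obtain ⟨q, hq⟩ := Option.isSome_iff_exists.1 (hp u (mem_vertices_of_adj h))
    obtain ⟨q', hq'⟩ := Option.isSome_iff_exists.1 (hp v (mem_vertices_of_adj h.symm))
    simp only [hq, hq', Option.elim]
    -- The loop out to u, across the edge to v and back to the base vertex is contractible.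
    have := (hT ε hε).holonomy_eq (hQ.2 o ho (q.append (.cons h q'.reverse)))
    rw [holonomy_append] at this
    simp only [holonomy] at this
    rw [(hT ε hε).holonomy_reverse, ← mul_assoc] at this
    exact (mul_inv_eq_one.1 this).symm

end Holonomy

/-! ### Squares of the complex -/

section Squares

variable {Q : SquareComplex} {v : ℤ × ℤ} {a b : ℤˣ}

theorem horVertex_diagVertex (v : ℤ × ℤ) (a b : ℤˣ) :
    horVertex (diagVertex v a b) (-a) = verVertex v b := by
  simp [horVertex, diagVertex, verVertex]

theorem verVertex_diagVertex (v : ℤ × ℤ) (a b : ℤˣ) :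
    verVertex (diagVertex v a b) (-b) = horVertex v a := by
  simp [horVertex, diagVertex, verVertex]

theorem diagVertex_diagVertex (v : ℤ × ℤ) (a b : ℤˣ) :
    diagVertex (diagVertex v a b) (-a) (-b) = v := by
  simp [diagVertex]

theorem odd_horVertex (hv : Even (v.1 + v.2)) (a : ℤˣ) :
    ¬ Even ((horVertex v a).1 + (horVertex v a).2) := by
  rcases Int.units_eq_one_or a with rfl | rfl <;>
    simp only [horVertex, Units.val_one, Units.val_neg] <;> grind

theorem odd_verVertex (hv : Even (v.1 + v.2)) (b : ℤˣ) :
    ¬ Even ((verVertex v b).1 + (verVertex v b).2) := by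
  rcases Int.units_eq_one_or b with rfl | rfl <;>
    simp only [verVertex, Units.val_one, Units.val_neg] <;> grind

theorem even_diagVertex (hv : Even (v.1 + v.2)) (a b : ℤˣ) :
    Even ((diagVertex v a b).1 + (diagVertex v a b).2) := by
  rcases Int.units_eq_one_or a with rfl | rfl <;> rcases Int.units_eq_one_or b with rfl | rfl <;>
    simp only [diagVertex, Units.val_one, Units.val_neg] <;> grind

theorem HasSquare.diag (h : HasSquare Q v a b) : HasSquare Q (diagVertex v a b) (-a) (-b) := by
  unfold HasSquare at *
  convert h using 2 <;> simp [diagVertex, min_comm]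

theorem corners_hasSquare (v : ℤ × ℤ) (a b : ℤˣ) :
    corners (min v.1 (v.1 + a), min v.2 (v.2 + b)) =
      {v, horVertex v a, verVertex v b, diagVertex v a b} := by
  obtain ⟨x, y⟩ := v
  ext ⟨m, n⟩
  rcases Int.units_eq_one_or a with rfl | rfl <;> rcases Int.units_eq_one_or b with rfl | rfl <;>
    simp [corners, horVertex, verVertex, diagVertex] <;> omega

/-- Every square is named by one of its even corners and the direction to the opposite corner. -/
theorem exists_hasSquare {s : ℤ × ℤ} (hs : s ∈ Q) :
    ∃ v a b, Even (v.1 + v.2) ∧ HasSquare Q v a b ∧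
      s = (min v.1 (v.1 + a), min v.2 (v.2 + b)) := by
  by_cases h : Even (s.1 + s.2)
  · refine ⟨s, 1, 1, h, ?_, ?_⟩ <;> simp [HasSquare, hs]
  · refine ⟨(s.1 + 1, s.2), -1, 1, ?_, ?_, ?_⟩
    · simp only; grind
    all_goals simp [HasSquare, hs]

theorem HasSquare.mem_vertices (h : HasSquare Q v a b) {x : ℤ × ℤ}
    (hx : x = v ∨ x = horVertex v a ∨ x = verVertex v b ∨ x = diagVertex v a b) :
    x ∈ vertices Q :=
  Finset.mem_biUnion.2 ⟨_, h, by rw [corners_hasSquare]; simpa using hx⟩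

theorem HasSquare.mem_ringVertices (h : HasSquare Q v a b) (hv : Even (v.1 + v.2)) :
    v ∈ ringVertices Q :=
  Finset.mem_filter.2 ⟨h.mem_vertices (.inl rfl), hv⟩

theorem even_of_mem_ringVertices (h : v ∈ ringVertices Q) : Even (v.1 + v.2) :=
  (Finset.mem_filter.1 h).2

theorem HasSquare.adj_hor (h : HasSquare Q v a b) : (edgeGraph Q).Adj v (horVertex v a) := by
  refine ⟨?_, _, h, ?_, ?_⟩
  · rcases Int.units_eq_one_or a with rfl | rfl <;> simp [horVertex]
  all_goals simp [corners_hasSquare]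

theorem HasSquare.adj_ver (h : HasSquare Q v a b) : (edgeGraph Q).Adj v (verVertex v b) := by
  refine ⟨?_, _, h, ?_, ?_⟩
  · rcases Int.units_eq_one_or b with rfl | rfl <;> simp [verVertex]
  all_goals simp [corners_hasSquare]

theorem HasSquare.adj_hor_diag (h : HasSquare Q v a b) :
    (edgeGraph Q).Adj (horVertex v a) (diagVertex v a b) := by
  have := h.diag.adj_ver.symm
  rwa [verVertex_diagVertex] at this

theorem HasSquare.adj_ver_diag (h : HasSquare Q v a b) :
    (edgeGraph Q).Adj (verVertex v b) (diagVertex v a b) := by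
  have := h.diag.adj_hor.symm
  rwa [horVertex_diagVertex] at this

theorem even_iff_of_adj {x y : ℤ × ℤ} (h : (edgeGraph Q).Adj x y) :
    Even (x.1 + x.2) ↔ ¬ Even (y.1 + y.2) := by
  have := h.1
  obtain ⟨x1, x2⟩ := x
  obtain ⟨y1, y2⟩ := y
  simp only at *
  grind

/-- Every edge of the complex that starts at an even vertex is a side of a square. -/
theorem exists_hasSquare_of_adj {x y : ℤ × ℤ} (h : (edgeGraph Q).Adj x y) (hx : Even (x.1 + x.2)) :
    ∃ a b, HasSquare Q x a b ∧ (y = horVertex x a ∨ y = verVertex x b) := by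
  have hy := (even_iff_of_adj h).1 hx
  obtain ⟨-, s, hs, hxs, hys⟩ := h
  obtain ⟨v, a, b, hv, h, rfl⟩ := exists_hasSquare hs
  have h1 := odd_horVertex hv a
  have h2 := odd_verVertex hv b
  have h3 := even_diagVertex hv a b
  rw [corners_hasSquare] at hxs hys
  simp only [Finset.mem_insert, Finset.mem_singleton] at hxs hys
  have hy' : y = horVertex v a ∨ y = verVertex v b := by
    rcases hys with rfl | rfl | rfl | rfl <;> tauto
  have hx' : x = v ∨ x = diagVertex v a b := by
    rcases hxs with rfl | rfl | rfl | rfl <;> tauto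
  rcases hx' with rfl | rfl
  · exact ⟨a, b, h, hy'⟩
  · refine ⟨-a, -b, h.diag, ?_⟩
    rw [horVertex_diagVertex, verVertex_diagVertex]
    exact hy'.symm

/-- One relation for a four-cycle gives all its versions with other starting points and directions,
including the degenerate ones that backtrack. -/
theorem two_step_transport_eq {G V : Type*} [Group G] {T : V → V → G} {v w l l' x y z t : V}
    (h1 : T l v = (T v l)⁻¹) (h2 : T l' v = (T v l')⁻¹) (h3 : T w l = (T l w)⁻¹)
    (h4 : T w l' = (T l' w)⁻¹) (e : T v l * T l w = T v l' * T l' w)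
    (hx : x = v ∨ x = w) (hz : z = v ∨ z = w) (hy : y = l ∨ y = l') (ht : t = l ∨ t = l') :
    T x y * T y z = T x t * T t z := by
  have e' : (T l w)⁻¹ * (T v l)⁻¹ = (T l' w)⁻¹ * (T v l')⁻¹ := by
    rw [← mul_inv_rev, e, mul_inv_rev]
  rcases hx with rfl | rfl <;> rcases hz with rfl | rfl <;>
    rcases hy with rfl | rfl <;> rcases ht with rfl | rfl <;>
    simp only [h1, h2, h3, h4, e, e', mul_inv_cancel, inv_mul_cancel]

/-- Flatness can be checked in terms of the even corners of the squares. -/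
theorem isFlat_of_squares {G : Type*} [Group G] {T : ℤ × ℤ → ℤ × ℤ → G}
    (h1 : ∀ u v, (edgeGraph Q).Adj u v → T u v * T v u = 1)
    (h2 : ∀ v a b, Even (v.1 + v.2) → HasSquare Q v a b →
      T v (horVertex v a) * T (horVertex v a) (diagVertex v a b) =
        T v (verVertex v b) * T (verVertex v b) (diagVertex v a b)) : IsFlat Q T := by
  refine ⟨h1, ?_⟩
  intro s hs x hx y hy z hz t ht hxy hyz hxt htz
  obtain ⟨v, a, b, hv, h, rfl⟩ := exists_hasSquare hs
  have inv : ∀ u v, (edgeGraph Q).Adj u v → T v u = (T u v)⁻¹ :=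
    fun u v h => eq_inv_of_mul_eq_one_right (h1 u v h)
  have i1 := inv _ _ h.adj_hor
  have i2 := inv _ _ h.adj_ver
  have i3 := inv _ _ h.adj_hor_diag
  have i4 := inv _ _ h.adj_ver_diag
  have e := h2 v a b hv h
  -- The same relation read between the two odd corners.
  have e' : T (horVertex v a) v * T v (verVertex v b) =
      T (horVertex v a) (diagVertex v a b) * T (diagVertex v a b) (verVertex v b) := by
    rw [i1, i4, inv_mul_eq_iff_eq_mul, ← mul_assoc, e, mul_inv_cancel_right]
  have par : ∀ u ∈ corners (min v.1 (v.1 + a), min v.2 (v.2 + b)),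
      (Even (u.1 + u.2) → u = v ∨ u = diagVertex v a b) ∧
      (¬ Even (u.1 + u.2) → u = horVertex v a ∨ u = verVertex v b) := by
    have o1 := odd_horVertex hv a
    have o2 := odd_verVertex hv b
    have o3 := even_diagVertex hv a b
    intro u hu
    rw [corners_hasSquare] at hu
    simp only [Finset.mem_insert, Finset.mem_singleton] at hu
    rcases hu with rfl | rfl | rfl | rfl <;> tauto
  have pxy := even_iff_of_adj hxy
  have pyz := even_iff_of_adj hyz
  have pxt := even_iff_of_adj hxt
  by_cases hxe : Even (x.1 + x.2)
  · exact two_step_transport_eq i1 i2 i3 i4 e ((par x hx).1 hxe) ((par z hz).1 (by tauto))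
      ((par y hy).2 (pxy.1 hxe)) ((par t ht).2 (pxt.1 hxe))
  · exact two_step_transport_eq (by rw [i1, inv_inv]) i3 i2
      (by rw [i4, inv_inv]) e' ((par x hx).2 hxe) ((par z hz).2 (by tauto))
      ((par y hy).1 (by tauto)) ((par t ht).1 (by tauto))

end Squares

/-- Prescribed increments around a vertex, which add up to zero if there are four of them, come from
functions on the directions. -/
theorem exists_increments (S : ℤˣ → ℤˣ → Prop) (η : ℝ → ℤˣ → ℤˣ → ℝ) (I : Set ℝ)
    (hc : ∀ a b, S a b → ContinuousOn (fun ε => η ε a b) I) (h0 : ∀ a b, S a b → η 0 a b = 0)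
    (hsum : (∀ a b, S a b) → ∀ ε ∈ I, η ε 1 1 + η ε (-1) 1 + η ε (-1) (-1) + η ε 1 (-1) = 0) :
    ∃ h k : ℝ → ℤˣ → ℝ, (∀ a, h 0 a = 0) ∧ (∀ b, k 0 b = 0) ∧
      (∀ a, ContinuousOn (fun ε => h ε a) I) ∧ (∀ b, ContinuousOn (fun ε => k ε b) I) ∧
      ∀ ε ∈ I, ∀ a b, S a b → k ε b - h ε a = ((a * b : ℤˣ) : ℤ) * η ε a b := by
  classical
  obtain ⟨ξ, hξ, hξc, hξ0, hξs⟩ : ∃ ξ : ℝ → ℤˣ → ℤˣ → ℝ, (∀ ε a b, S a b → ξ ε a b = η ε a b) ∧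
      (∀ a b, ContinuousOn (fun ε => ξ ε a b) I) ∧ (∀ a b, ξ 0 a b = 0) ∧
      ∀ ε ∈ I, ξ ε 1 1 + ξ ε (-1) 1 + ξ ε (-1) (-1) + ξ ε 1 (-1) = 0 := by
    by_cases hS : ∀ a b, S a b
    · exact ⟨η, fun _ _ _ _ => rfl, fun a b => hc a b (hS a b), fun a b => h0 a b (hS a b), hsum hS⟩
    · push Not at hS
      obtain ⟨a₀, b₀, hS⟩ := hS
      let ζ : ℝ → ℤˣ → ℤˣ → ℝ := fun ε a b => if S a b then η ε a b else 0
      have ζc : ∀ a b, ContinuousOn (fun ε => ζ ε a b) I := fun a b => by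
        by_cases h : S a b
        · simpa only [ζ, h, if_true] using hc a b h
        · simpa only [ζ, h, if_false] using continuousOn_const
      have ζ0 : ∀ a b, ζ 0 a b = 0 := fun a b => by
        by_cases h : S a b
        · simpa only [ζ, h, if_true] using h0 a b h
        · simp only [ζ, h, if_false]
      let σ : ℝ → ℝ := fun ε => ζ ε 1 1 + ζ ε (-1) 1 + ζ ε (-1) (-1) + ζ ε 1 (-1)
      have σc : ContinuousOn σ I := (((ζc _ _).add (ζc _ _)).add (ζc _ _)).add (ζc _ _)
      -- The increment across a missing square is free and is chosen to make the total zero.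
      refine ⟨fun ε a b => if a = a₀ ∧ b = b₀ then ζ ε a b - σ ε else ζ ε a b, fun ε a b h => ?_,
        fun a b => ?_, fun a b => ?_, fun ε _ => ?_⟩
      · have : ¬ (a = a₀ ∧ b = b₀) := by rintro ⟨rfl, rfl⟩; exact hS h
        simp only [this, if_false, ζ, h, if_true]
      · by_cases h : a = a₀ ∧ b = b₀
        · simp only [h, and_self, if_true]
          exact (ζc _ _).sub σc
        · simpa only [h, if_false] using ζc a b
      · simp only [ζ0, σ, add_zero, sub_zero, ite_self]
      · rcases Int.units_eq_one_or a₀ with rfl | rfl <;>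
          rcases Int.units_eq_one_or b₀ with rfl | rfl <;> simp [σ] <;> ring
  -- Partial sums in the order right, up, left, down, starting with 0 on the right. The vanishing
  -- total closes the cycle from down to right.
  refine ⟨fun ε a => if a = 1 then 0 else ξ ε 1 1 + ξ ε (-1) 1,
    fun ε b => if b = 1 then ξ ε 1 1 else ξ ε 1 1 + ξ ε (-1) 1 + ξ ε (-1) (-1), fun a => ?_,
    fun b => ?_, fun a => ?_, fun b => ?_, fun ε hε a b h => ?_⟩
  · simp [hξ0]
  · simp [hξ0]
  · by_cases h : a = 1
    · simpa only [h, if_true] using continuousOn_const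
    · simp only [h, if_false]
      exact (hξc _ _).add (hξc _ _)
  · by_cases h : b = 1
    · simpa only [h, if_true] using hξc _ _
    · simp only [h, if_false]
      exact ((hξc _ _).add (hξc _ _)).add (hξc _ _)
  · rw [← hξ _ _ _ h]
    have := hξs ε hε
    rcases Int.units_eq_one_or a with rfl | rfl <;>
      rcases Int.units_eq_one_or b with rfl | rfl <;> simp
    linarith

/-! ### Frames along the edges of a pattern -/

/-- The length of the edge `x y` in a pattern with radii `r`, `R`. -/
def edgeLength (r R : ℤ × ℤ → ℝ) (x y : ℤ × ℤ) : ℝ :=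
  if x.2 = y.2 then r (if Even (x.1 + x.2) then x else y)
  else R (if Even (x.1 + x.2) then x else y)

section EdgeLength

variable (r R : ℤ × ℤ → ℝ) {v : ℤ × ℤ} (a b : ℤˣ)

theorem edgeLength_hor (hv : Even (v.1 + v.2)) : edgeLength r R v (horVertex v a) = r v := by
  simp [edgeLength, hv, horVertex]

theorem edgeLength_ver (hv : Even (v.1 + v.2)) : edgeLength r R v (verVertex v b) = R v := by
  rcases Int.units_eq_one_or b with rfl | rfl <;> simp [edgeLength, hv, verVertex]

theorem edgeLength_comm {Q : SquareComplex} {x y : ℤ × ℤ} (h : (edgeGraph Q).Adj x y) :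
    edgeLength r R y x = edgeLength r R x y := by
  have := even_iff_of_adj h
  unfold edgeLength
  by_cases hx : Even (x.1 + x.2)
  · simp [hx, this.1 hx, eq_comm]
  · simp [hx, not_not.1 (mt this.2 hx), eq_comm]

end EdgeLength

/-- The position of a vertex in a pattern: the centre of the ring or the point. -/
def Rings.position (P : Rings) (x : ℤ × ℤ) : S2 :=
  if Even (x.1 + x.2) then P.center x else P.point x

theorem Rings.position_even (P : Rings) {x : ℤ × ℤ} (hx : Even (x.1 + x.2)) :
    P.position x = P.center x := if_pos hx

theorem Rings.position_odd (P : Rings) {x : ℤ × ℤ} (hx : ¬ Even (x.1 + x.2)) :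
    P.position x = P.point x := if_neg hx

/-- The sum of the angles at `v` in a pattern of positively oriented rings with radii `r`, `R`. -/
def kiteSum (Q : SquareComplex) (r R : ℤ × ℤ → ℝ) (v : ℤ × ℤ) : ℝ :=
  ∑ d : ℤˣ × ℤˣ, if HasSquare Q v d.1 d.2 then
    kiteAngle (r v) (R v) (r (diagVertex v d.1 d.2)) (R (diagVertex v d.1 d.2)) else 0

/-- A choice of frames along the edges, for a pattern with radii `r`, `R`. -/
structure EdgeFrames (Q : SquareComplex) (P : Rings) (r R : ℤ × ℤ → ℝ)
    (B : ℤ × ℤ → ℤ × ℤ → SO3) : Prop where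
  isFrame : ∀ x y, (edgeGraph Q).Adj x y →
    IsFrame (B x y) (P.position x) (P.position y) (edgeLength r R x y)
  even_angle : ∀ v a b, Even (v.1 + v.2) → HasSquare Q v a b →
    B v (verVertex v b) = B v (horVertex v a) * rotZ (((a * b : ℤˣ) : ℤ) *
      kiteAngle (r v) (R v) (r (diagVertex v a b)) (R (diagVertex v a b)))
  odd_angle : ∀ v a b, Even (v.1 + v.2) → HasSquare Q v a b →
    B (horVertex v a) v = B (horVertex v a) (diagVertex v a b) *
      rotZ (((a * b : ℤˣ) : ℤ) * (π / 2))

theorem unit_cast_mul (a b : ℤˣ) :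
    (((a * b : ℤˣ) : ℤ) : ℝ) = 1 ∨ (((a * b : ℤˣ) : ℤ) : ℝ) = -1 := by
  rcases Int.units_eq_one_or (a * b) with h | h <;> simp only [h] <;> simp

theorem unit_mul_of_eq {a b : ℤˣ} (h : a = b) : (((a * b : ℤˣ) : ℤ) : ℝ) = 1 := by
  rw [h]; simp

theorem unit_mul_of_ne {a b : ℤˣ} (h : a ≠ b) : (((a * b : ℤˣ) : ℤ) : ℝ) = -1 := by
  rcases Int.units_eq_one_or a with rfl | rfl <;> rcases Int.units_eq_one_or b with rfl | rfl <;>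
    simp at *

section OfFrames

variable {Q : SquareComplex} {P : Rings} {B : ℤ × ℤ → ℤ × ℤ → SO3}

theorem EdgeFrames.isFrame_hor (h : EdgeFrames Q P P.r P.R B) {v : ℤ × ℤ} {a b : ℤˣ}
    (hv : Even (v.1 + v.2)) (hs : HasSquare Q v a b) :
    IsFrame (B v (horVertex v a)) (P.center v) (P.point (horVertex v a)) (P.r v) := by
  have := h.isFrame _ _ hs.adj_hor
  rwa [P.position_even hv, P.position_odd (odd_horVertex hv a), edgeLength_hor _ _ _ hv] at this

theorem EdgeFrames.isFrame_ver (h : EdgeFrames Q P P.r P.R B) {v : ℤ × ℤ} {a b : ℤˣ}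
    (hv : Even (v.1 + v.2)) (hs : HasSquare Q v a b) :
    IsFrame (B v (verVertex v b)) (P.center v) (P.point (verVertex v b)) (P.R v) := by
  have := h.isFrame _ _ hs.adj_ver
  rwa [P.position_even hv, P.position_odd (odd_verVertex hv b), edgeLength_ver _ _ _ hv] at this

theorem EdgeFrames.theta_eq (h : EdgeFrames Q P P.r P.R B)
    (hr : ∀ v ∈ ringVertices Q, P.r v ∈ Set.Ioo 0 (π / 2))
    (hR : ∀ v ∈ ringVertices Q, P.R v ∈ Set.Ioo 0 (π / 2)) {v : ℤ × ℤ} {a b : ℤˣ}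
    (hv : Even (v.1 + v.2)) (hs : HasSquare Q v a b) :
    P.theta v a b =
      kiteAngle (P.r v) (P.R v) (P.r (diagVertex v a b)) (P.R (diagVertex v a b)) := by
  have m := hs.mem_ringVertices hv
  have m' := hs.diag.mem_ringVertices (even_diagVertex hv a b)
  have k := kiteAngle_mem (hr _ m) (hR _ m) (hr _ m') (hR _ m')
  have k' : kiteAngle (P.r v) (P.R v) (P.r (diagVertex v a b)) (P.R (diagVertex v a b)) ∈
    Set.Ioc (-π) π := ⟨by linarith [k.1, Real.pi_pos], k.2.le⟩
  have s1 := sin_pos_of_acute (hr _ m)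
  have s2 := sin_pos_of_acute (hR _ m)
  have f1 := h.isFrame_hor hv hs
  have f2 := h.isFrame_ver hv hs
  have e := h.even_angle v a b hv hs
  unfold Rings.theta
  split_ifs with hab
  · rw [unit_mul_of_eq hab, one_mul] at e
    rw [e] at f2
    exact f1.orientedAngle_eq f2 s1 s2 k'
  -- Here the cyclic order runs from the vertical to the horizontal point, so the relation between
  -- the frames is inverted.
  · rw [unit_mul_of_ne hab, neg_one_mul, rotZ_neg, eq_mul_inv_iff_mul_eq] at e
    rw [← e] at f1
    exact f2.orientedAngle_eq f1 s2 s1 k'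

theorem EdgeFrames.coneAngle_eq (h : EdgeFrames Q P P.r P.R B)
    (hr : ∀ v ∈ ringVertices Q, P.r v ∈ Set.Ioo 0 (π / 2))
    (hR : ∀ v ∈ ringVertices Q, P.R v ∈ Set.Ioo 0 (π / 2)) {v : ℤ × ℤ}
    (hv : Even (v.1 + v.2)) : P.coneAngle Q v = kiteSum Q P.r P.R v := by
  unfold Rings.coneAngle kiteSum
  refine Finset.sum_congr rfl fun d _ => ?_
  split_ifs with hs
  · exact h.theta_eq hr hR hv hs
  · rfl

theorem EdgeFrames.isRingPattern (h : EdgeFrames Q P P.r P.R B)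
    (hr : ∀ v ∈ ringVertices Q, P.r v ∈ Set.Ioo 0 (π / 2))
    (hR : ∀ v ∈ ringVertices Q, P.R v ∈ Set.Ioo 0 (π / 2))
    (hle : ∀ v ∈ ringVertices Q, P.r v ≤ P.R v)
    (hsum : ∀ v ∈ innerRings Q, kiteSum Q P.r P.R v = 2 * π) : IsRingPattern Q P where
  r_ne_zero v hv := (hr v hv).1.ne'
  abs_r_le v hv := by rw [abs_of_pos (hr v hv).1]; exact hle v hv
  R_lt v hv := (hR v hv).2
  mem_inner v hv a b hs := by
    rw [abs_of_pos (hr v hv).1, sphericalCircle, Set.mem_ofPred_eq,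
      angle_eq_iff _ _ (hr v hv).1.le (by linarith [(hr v hv).2, Real.pi_pos]), real_inner_comm]
    exact (h.isFrame_hor (even_of_mem_ringVertices hv) hs).inner_eq
  mem_outer v hv a b hs := by
    rw [sphericalCircle, Set.mem_ofPred_eq,
      angle_eq_iff _ _ (hR v hv).1.le (by linarith [(hR v hv).2, Real.pi_pos]), real_inner_comm]
    exact (h.isFrame_ver (even_of_mem_ringVertices hv) hs).inner_eq
  orthogonal v hv a b hs := by
    have ev := even_of_mem_ringVertices hv
    have ew := even_diagVertex ev a b
    have m' := hs.diag.mem_ringVertices ew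
    have f1 := h.isFrame _ _ hs.adj_hor.symm
    have f2 := h.isFrame _ _ hs.adj_hor_diag
    rw [P.position_even ev, P.position_odd (odd_horVertex ev a), edgeLength_comm _ _ hs.adj_hor,
      edgeLength_hor _ _ _ ev] at f1
    have l := edgeLength_ver P.r P.R (-b) ew
    rw [verVertex_diagVertex, edgeLength_comm _ _ hs.adj_hor_diag] at l
    rw [P.position_even ew, P.position_odd (odd_horVertex ev a), l] at f2
    rw [OrthogonalAt, real_inner_comm]
    exact (orthogonalAt_iff f2 f1 (sin_pos_of_acute (hR _ m')).ne'
      (sin_pos_of_acute (hr _ hv)).ne').2 ⟨_, unit_cast_mul a b, h.odd_angle v a b ev hs⟩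
  orientation v hv a b hs := by
    have ev := even_of_mem_ringVertices hv
    have m' := hs.diag.mem_ringVertices (even_diagVertex ev a b)
    have k := kiteAngle_mem (hr _ hv) (hR _ hv) (hr _ m') (hR _ m')
    rw [h.theta_eq hr hR ev hs]
    exact ⟨mul_pos (hr v hv).1 k.1, by rw [abs_of_pos k.1]; exact k.2⟩
  closing v hv := by
    have m : v ∈ ringVertices Q := (Finset.mem_filter.1 hv).1
    rw [h.coneAngle_eq hr hR (even_of_mem_ringVertices m), hsum v hv, sign_pos (hr v m).1]
    simp

end OfFrames

/-! ### Frames of a circle pattern -/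

section CirclePattern

variable {Q : SquareComplex} {C : Rings}

theorem IsCirclePattern.radius_mem (hC : IsCirclePattern Q C) {v : ℤ × ℤ}
    (hv : v ∈ ringVertices Q) : C.R v ∈ Set.Ioo 0 (π / 2) := by
  refine ⟨?_, hC.1.R_lt v hv⟩
  have h1 := hC.1.abs_r_le v hv
  have h2 := hC.1.r_ne_zero v hv
  rw [hC.2 v hv] at h1 h2
  exact lt_of_le_of_ne ((abs_nonneg _).trans h1) h2.symm

theorem IsCirclePattern.inner_eq_of_even (hC : IsCirclePattern Q C) {x y : ℤ × ℤ}
    (h : (edgeGraph Q).Adj x y) (hx : Even (x.1 + x.2)) :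
    0 < Real.sin (edgeLength C.r C.R x y) ∧
    ⟪(C.position x : EuclideanSpace ℝ (Fin 3)), (C.position y : EuclideanSpace ℝ (Fin 3))⟫_ℝ =
      Real.cos (edgeLength C.r C.R x y) := by
  obtain ⟨a, b, hs, rfl | rfl⟩ := exists_hasSquare_of_adj h hx
  · have m := hs.mem_ringVertices hx
    have r := hC.radius_mem m
    rw [edgeLength_hor _ _ _ hx, C.position_even hx, C.position_odd (odd_horVertex hx a)]
    have := hC.1.mem_inner x m a b hs
    rw [hC.2 x m, abs_of_pos r.1, sphericalCircle, Set.mem_ofPred_eq, angle_eq_iff _ _ r.1.le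
      (by linarith [r.2, Real.pi_pos]), real_inner_comm] at this
    rw [hC.2 x m]
    exact ⟨sin_pos_of_acute r, this⟩
  · have m := hs.mem_ringVertices hx
    have r := hC.radius_mem m
    rw [edgeLength_ver _ _ _ hx, C.position_even hx, C.position_odd (odd_verVertex hx b)]
    have := hC.1.mem_outer x m a b hs
    rw [sphericalCircle, Set.mem_ofPred_eq, angle_eq_iff _ _ r.1.le
      (by linarith [r.2, Real.pi_pos]), real_inner_comm] at this
    exact ⟨sin_pos_of_acute r, this⟩

theorem IsCirclePattern.inner_eq (hC : IsCirclePattern Q C) {x y : ℤ × ℤ}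
    (h : (edgeGraph Q).Adj x y) :
    0 < Real.sin (edgeLength C.r C.R x y) ∧
    ⟪(C.position x : EuclideanSpace ℝ (Fin 3)), (C.position y : EuclideanSpace ℝ (Fin 3))⟫_ℝ =
      Real.cos (edgeLength C.r C.R x y) := by
  by_cases hx : Even (x.1 + x.2)
  · exact hC.inner_eq_of_even h hx
  · have hy := not_not.1 (mt (even_iff_of_adj h).2 hx)
    rw [← edgeLength_comm _ _ h, real_inner_comm]
    exact hC.inner_eq_of_even h.symm hy

/-- Frames along edges exist since the edge lengths lie strictly between 0 and π/2, and they are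
unique, so the two frames of an edge correspond under the half turn. The orientation condition puts
the angles at the centres into (0, π), and `kite_rigid` then evaluates them. -/
theorem IsCirclePattern.exists_frames (hC : IsCirclePattern Q C) :
    ∃ B, EdgeFrames Q C C.r C.R B ∧
      ∀ x y, (edgeGraph Q).Adj x y → B y x = B x y * halfTurn (edgeLength C.r C.R x y) := by
  have : ∀ x y, ∃ g, (edgeGraph Q).Adj x y →
      IsFrame g (C.position x) (C.position y) (edgeLength C.r C.R x y) := fun x y => by
    by_cases h : (edgeGraph Q).Adj x y
    · obtain ⟨h1, h2⟩ := hC.inner_eq h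
      obtain ⟨g, hg⟩ := exists_frame h1.ne' h2
      exact ⟨g, fun _ => hg⟩
    · exact ⟨1, fun h' => absurd h' h⟩
  choose B hB using this
  have hsymm : ∀ x y, (edgeGraph Q).Adj x y →
      B y x = B x y * halfTurn (edgeLength C.r C.R x y) := fun x y h => by
    have := hB y x h.symm
    rw [edgeLength_comm _ _ h] at this
    exact this.unique (hC.inner_eq h).1.ne' (hB x y h).symm
  have key : ∀ v a b, Even (v.1 + v.2) → HasSquare Q v a b → ∃ φ ∈ Set.Ioo 0 π,
      B v (verVertex v b) = B v (horVertex v a) * rotZ (((a * b : ℤˣ) : ℤ) * φ) := by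
    intro v a b hv hs
    have m := hs.mem_ringVertices hv
    have r := hC.radius_mem m
    have f1 := hB _ _ hs.adj_hor
    have f2 := hB _ _ hs.adj_ver
    rw [C.position_even hv, C.position_odd (odd_horVertex hv a), edgeLength_hor _ _ _ hv,
      hC.2 v m] at f1
    rw [C.position_even hv, C.position_odd (odd_verVertex hv b), edgeLength_ver _ _ _ hv] at f2
    have o := hC.1.orientation v m a b hs
    rw [hC.2 v m, mul_pos_iff_of_pos_left r.1, Rings.theta] at o
    have sp := sin_pos_of_acute r
    split_ifs at o with hab
    · obtain ⟨α, hα, e⟩ := exists_eq_mul_rotZ (f1.1.trans f2.1.symm)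
      rw [e] at f2
      rw [f1.orientedAngle_eq f2 sp sp hα] at o
      exact ⟨α, ⟨o.1, (le_abs_self α).trans_lt o.2⟩, by rw [unit_mul_of_eq hab, one_mul, e]⟩
    · obtain ⟨α, hα, e⟩ := exists_eq_mul_rotZ (f2.1.trans f1.1.symm)
      rw [e] at f1
      rw [f2.orientedAngle_eq f1 sp sp hα] at o
      exact ⟨α, ⟨o.1, (le_abs_self α).trans_lt o.2⟩, by
        rw [unit_mul_of_ne hab, neg_one_mul, e, rotZ_neg, mul_inv_cancel_right]⟩
  have main : ∀ v a b, Even (v.1 + v.2) → HasSquare Q v a b →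
      B v (verVertex v b) = B v (horVertex v a) * rotZ (((a * b : ℤˣ) : ℤ) *
        kiteAngle (C.r v) (C.R v) (C.r (diagVertex v a b)) (C.R (diagVertex v a b))) ∧
      B (horVertex v a) v = B (horVertex v a) (diagVertex v a b) *
        rotZ (((a * b : ℤˣ) : ℤ) * (π / 2)) := by
    intro v a b hv hs
    have hw := even_diagVertex hv a b
    have m := hs.mem_ringVertices hv
    have m' := hs.diag.mem_ringVertices hw
    obtain ⟨φ, hφ, eφ⟩ := key v a b hv hs
    -- The same square seen from its other even corner: both signs change, so the product a b, and
    -- with it the orientation, stays the same.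
    obtain ⟨ψ, hψ, eψ⟩ := key _ _ _ hw hs.diag
    rw [horVertex_diagVertex, verVertex_diagVertex, neg_mul_neg] at eψ
    have f1 := hB _ _ hs.adj_hor
    have f2 := hB _ _ hs.adj_ver
    have f3 := hB _ _ hs.adj_hor_diag.symm
    have f4 := hB _ _ hs.adj_ver_diag.symm
    have l3 := edgeLength_ver C.r C.R (-b) hw
    have l4 := edgeLength_hor C.r C.R (-a) hw
    rw [verVertex_diagVertex] at l3
    rw [horVertex_diagVertex, hC.2 _ m'] at l4
    rw [C.position_even hv, C.position_odd (odd_horVertex hv a), edgeLength_hor _ _ _ hv,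
      hC.2 v m] at f1
    rw [C.position_even hv, C.position_odd (odd_verVertex hv b), edgeLength_ver _ _ _ hv] at f2
    rw [C.position_even hw, C.position_odd (odd_horVertex hv a), l3] at f3
    rw [C.position_even hw, C.position_odd (odd_verVertex hv b), l4] at f4
    have o := hC.1.orthogonal v m a b hs
    have o' := hC.1.orthogonal _ m' _ _ hs.diag
    rw [horVertex_diagVertex, diagVertex_diagVertex] at o'
    obtain ⟨h1, -, h3, -⟩ := kite_rigid (hC.radius_mem m) (hC.radius_mem m') (unit_cast_mul a b)
      f1 f2 f3 f4 o o' eφ hφ eψ hψ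
    rw [hC.2 v m, hC.2 _ m', ← h1]
    refine ⟨eφ, ?_⟩
    rw [hsymm _ _ hs.adj_hor, edgeLength_hor _ _ _ hv, hC.2 v m, h3,
      hsymm _ _ hs.adj_hor_diag.symm, l3]
  exact ⟨B, ⟨hB, fun v a b hv hs => (main v a b hv hs).1, fun v a b hv hs => (main v a b hv hs).2⟩,
    hsymm⟩

theorem IsCirclePattern.coneAngle_eq (hC : IsCirclePattern Q C) {v : ℤ × ℤ}
    (hv : v ∈ ringVertices Q) : C.coneAngle Q v = kiteSum Q C.r C.R v := by
  obtain ⟨B, hB, -⟩ := hC.exists_frames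
  exact hB.coneAngle_eq (fun v hv => by rw [hC.2 v hv]; exact hC.radius_mem hv)
    (fun v hv => hC.radius_mem hv) (even_of_mem_ringVertices hv)

end CirclePattern

/-! ### Laying out a family of patterns with given radii -/

/-- The pattern obtained from `C` by rotating every centre and point and changing the radii. -/
def Rings.displace (C : Rings) (A : ℤ × ℤ → SO3) (r R : ℤ × ℤ → ℝ) : Rings where
  center v := rotate (A v) (C.center v)
  point v := rotate (A v) (C.point v)
  r := r
  R := R

theorem Rings.position_displace (C : Rings) (A : ℤ × ℤ → SO3) (r R : ℤ × ℤ → ℝ) (x : ℤ × ℤ) :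
    (C.displace A r R).position x = rotate (A x) (C.position x) := by
  unfold Rings.position
  split_ifs <;> rfl

/-- The transport along an edge that changes its length to `d`, and its directions at the end points
by `δ x y` and `δ y x`. -/
def edgeTransport (B : ℤ × ℤ → ℤ × ℤ → SO3) (δ d : ℤ × ℤ → ℤ × ℤ → ℝ) (x y : ℤ × ℤ) : SO3 :=
  B x y * rotZ (δ x y) * halfTurn (d x y) * (B y x * rotZ (δ y x))⁻¹

/-- The primed and unprimed frames at each corner differ by the turn there, so the equality of the
two transports around the kite is conjugate to the closing relation `K`. -/
theorem kite_transport_eq {G : Type*} [Group G] {b b' c c' p p' q q' X Y N i i' j j' : G}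
    (hb : b' = b * X) (hc : c = c' * Y) (hp : p = p' * N) (hq : q' = q * N)
    (K : i * N⁻¹ * i' * Y⁻¹ = X * j * N * j') :
    b * i * p⁻¹ * (p' * i' * c⁻¹) = b' * j * q⁻¹ * (q' * j' * c'⁻¹) := by
  subst hb hc hp hq
  calc _ = b * (i * N⁻¹ * i' * Y⁻¹) * c'⁻¹ := by group
    _ = _ := by rw [K]; group

theorem continuousOn_edgeLength {Q : SquareComplex} {I : Set ℝ} {r R : ℝ → ℤ × ℤ → ℝ}
    (hrc : ∀ v ∈ ringVertices Q, ContinuousOn (fun ε => r ε v) I)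
    (hRc : ∀ v ∈ ringVertices Q, ContinuousOn (fun ε => R ε v) I) {x y : ℤ × ℤ}
    (h : (edgeGraph Q).Adj x y) : ContinuousOn (fun ε => edgeLength (r ε) (R ε) x y) I := by
  have main : ∀ {x y : ℤ × ℤ}, (edgeGraph Q).Adj x y → Even (x.1 + x.2) →
      ContinuousOn (fun ε => edgeLength (r ε) (R ε) x y) I := by
    intro x y h hx
    obtain ⟨a, b, hs, rfl | rfl⟩ := exists_hasSquare_of_adj h hx
    · simpa only [edgeLength_hor _ _ _ hx] using hrc x (hs.mem_ringVertices hx)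
    · simpa only [edgeLength_ver _ _ _ hx] using hRc x (hs.mem_ringVertices hx)
  by_cases hx : Even (x.1 + x.2)
  · exact main h hx
  · simp only [← edgeLength_comm _ _ h]
    exact main h.symm (not_not.1 (mt (even_iff_of_adj h).2 hx))

/-- The changes of the kite angles are distributed over the edges at each even vertex. At an inner
ring this is consistent because the angle sum stays 2π. At odd vertices nothing turns, since all
angles there remain right angles. -/
theorem exists_directions {Q : SquareComplex} (I : Set ℝ) (h0 : 0 ∈ I) (r R : ℝ → ℤ × ℤ → ℝ)
    (hc : ∀ v a b, Even (v.1 + v.2) → HasSquare Q v a b →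
      ContinuousOn (fun ε => kiteAngle (r ε v) (R ε v) (r ε (diagVertex v a b))
        (R ε (diagVertex v a b))) I)
    (hsum : ∀ ε ∈ I, ∀ v ∈ innerRings Q, kiteSum Q (r ε) (R ε) v = 2 * π) :
    ∃ δ : ℝ → ℤ × ℤ → ℤ × ℤ → ℝ, (∀ x y, δ 0 x y = 0) ∧
      (∀ x y, ContinuousOn (fun ε => δ ε x y) I) ∧
      (∀ ε x y, ¬ Even (x.1 + x.2) → δ ε x y = 0) ∧
      ∀ ε ∈ I, ∀ v a b, Even (v.1 + v.2) → HasSquare Q v a b →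
        δ ε v (verVertex v b) - δ ε v (horVertex v a) = ((a * b : ℤˣ) : ℤ) *
          (kiteAngle (r ε v) (R ε v) (r ε (diagVertex v a b)) (R ε (diagVertex v a b)) -
            kiteAngle (r 0 v) (R 0 v) (r 0 (diagVertex v a b)) (R 0 (diagVertex v a b))) := by
  have key : ∀ v : ℤ × ℤ, ∃ h k : ℝ → ℤˣ → ℝ, Even (v.1 + v.2) →
      (∀ a, h 0 a = 0) ∧ (∀ b, k 0 b = 0) ∧
      (∀ a, ContinuousOn (fun ε => h ε a) I) ∧ (∀ b, ContinuousOn (fun ε => k ε b) I) ∧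
      ∀ ε ∈ I, ∀ a b, HasSquare Q v a b → k ε b - h ε a = ((a * b : ℤˣ) : ℤ) *
        (kiteAngle (r ε v) (R ε v) (r ε (diagVertex v a b)) (R ε (diagVertex v a b)) -
          kiteAngle (r 0 v) (R 0 v) (r 0 (diagVertex v a b)) (R 0 (diagVertex v a b))) := by
    intro v
    by_cases hv : Even (v.1 + v.2)
    · obtain ⟨h, k, H⟩ := exists_increments (HasSquare Q v) (fun ε a b =>
        kiteAngle (r ε v) (R ε v) (r ε (diagVertex v a b)) (R ε (diagVertex v a b)) -
          kiteAngle (r 0 v) (R 0 v) (r 0 (diagVertex v a b)) (R 0 (diagVertex v a b))) I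
        (fun a b hs => (hc v a b hv hs).sub continuousOn_const) (fun a b _ => sub_self _) (by
          intro hall ε hε
          have hin : v ∈ innerRings Q := by
            refine Finset.mem_filter.2 ⟨(hall 1 1).mem_ringVertices hv, ?_⟩
            simp only [valence, hall, Finset.filter_true]
            rfl
          have e1 := hsum ε hε v hin
          have e2 := hsum 0 h0 v hin
          have hu : (Finset.univ : Finset ℤˣ) = {1, -1} := rfl
          simp only [kiteSum, hall, if_true, Fintype.sum_prod_type, hu] at e1 e2
          rw [Finset.sum_pair (by decide), Finset.sum_pair (by decide),
            Finset.sum_pair (by decide)] at e1 e2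
          linarith)
      exact ⟨h, k, fun _ => H⟩
    · exact ⟨0, 0, fun h => absurd h hv⟩
  choose h k H using key
  -- The position of y relative to x tells which of the four directions is meant.
  refine ⟨fun ε x y => if Even (x.1 + x.2) then
    if y.2 = x.2 then h x ε (if y.1 = x.1 + 1 then 1 else -1)
    else k x ε (if y.2 = x.2 + 1 then 1 else -1) else 0, fun x y => ?_, fun x y => ?_,
    fun ε x y hx => if_neg hx, fun ε hε v a b hv hs => ?_⟩
  · by_cases hx : Even (x.1 + x.2)
    · simp only [hx, (H x hx).1, (H x hx).2.1, ite_self]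
    · simp only [hx, if_false]
  · by_cases hx : Even (x.1 + x.2)
    · by_cases hy : y.2 = x.2
      · simpa only [hx, hy, if_true] using (H x hx).2.2.1 _
      · simpa only [hx, hy, if_true, if_false] using (H x hx).2.2.2.1 _
    · simpa only [hx, if_false] using continuousOn_const
  · rw [← (H v hv).2.2.2.2 ε hε a b hs]
    rcases Int.units_eq_one_or a with rfl | rfl <;>
      rcases Int.units_eq_one_or b with rfl | rfl <;> simp [hv, horVertex, verVertex]

theorem continuousOn_legAngle {I : Set ℝ} {a b : ℝ → ℝ} (ha : ContinuousOn a I)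
    (hb : ContinuousOn b I) (ha' : ∀ ε ∈ I, a ε ∈ Set.Ioo 0 (π / 2))
    (hb' : ∀ ε ∈ I, b ε ∈ Set.Ioo 0 (π / 2)) :
    ContinuousOn (fun ε => legAngle (a ε) (b ε)) I := by
  unfold legAngle
  refine Real.continuous_arctan.comp_continuousOn (ContinuousOn.div ?_
    (Real.continuous_sin.comp_continuousOn ha) fun ε hε => (sin_pos_of_acute (ha' ε hε)).ne')
  intro ε hε
  exact (Real.continuousAt_tan.2 (cos_pos_of_acute (hb' ε hε)).ne').comp_continuousWithinAt (hb ε hε)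

/-- Over a simply connected complex a circle pattern can be deformed into ring patterns with any
prescribed radii for which the angles at the inner rings add up to `2π`. -/
theorem IsCirclePattern.exists_deformation {Q : SquareComplex} (hQ : SimplyConnected Q) {C : Rings}
    (hC : IsCirclePattern Q C) {I : Set ℝ} (h0 : 0 ∈ I) {r R : ℝ → ℤ × ℤ → ℝ}
    (hr0 : r 0 = C.r) (hR0 : R 0 = C.R)
    (hr : ∀ ε ∈ I, ∀ v ∈ ringVertices Q, r ε v ∈ Set.Ioo 0 (π / 2))
    (hR : ∀ ε ∈ I, ∀ v ∈ ringVertices Q, R ε v ∈ Set.Ioo 0 (π / 2))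
    (hle : ∀ ε ∈ I, ∀ v ∈ ringVertices Q, r ε v ≤ R ε v)
    (hq : ∀ ε ∈ I, ∃ q : ℝ, ∀ v ∈ ringVertices Q, q * Real.cos (r ε v) = Real.cos (R ε v))
    (hrc : ∀ v ∈ ringVertices Q, ContinuousOn (fun ε => r ε v) I)
    (hRc : ∀ v ∈ ringVertices Q, ContinuousOn (fun ε => R ε v) I)
    (hsum : ∀ ε ∈ I, ∀ v ∈ innerRings Q, kiteSum Q (r ε) (R ε) v = 2 * π) :
    ∃ P : ℝ → Rings, P 0 = C ∧ (∀ ε, (P ε).r = r ε) ∧ (∀ ε, (P ε).R = R ε) ∧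
      (∀ ε ∈ I, IsRingPattern Q (P ε) ∧
        ∀ v ∈ ringVertices Q, (P ε).coneAngle Q v = kiteSum Q (r ε) (R ε) v) ∧
      (∀ v, ContinuousOn (fun ε => (P ε).center v) I) ∧
      ∀ v, ContinuousOn (fun ε => (P ε).point v) I := by
  obtain ⟨B, hB, hBs⟩ := hC.exists_frames
  obtain ⟨δ, δ0, δc, δodd, hδ⟩ := exists_directions I h0 r R (fun v a b hv hs => by
    have m := hs.mem_ringVertices hv
    have m' := hs.diag.mem_ringVertices (even_diagVertex hv a b)
    exact (continuousOn_legAngle (hrc _ m) (hRc _ m') (fun ε hε => hr ε hε _ m)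
      (fun ε hε => hR ε hε _ m')).add (continuousOn_legAngle (hRc _ m) (hrc _ m')
      (fun ε hε => hR ε hε _ m) (fun ε hε => hr ε hε _ m'))) hsum
  have Bangle : ∀ ε ∈ I, ∀ v a b, Even (v.1 + v.2) → HasSquare Q v a b →
      B v (verVertex v b) * rotZ (δ ε v (verVertex v b)) =
        B v (horVertex v a) * rotZ (δ ε v (horVertex v a)) * rotZ (((a * b : ℤˣ) : ℤ) *
          kiteAngle (r ε v) (R ε v) (r ε (diagVertex v a b)) (R ε (diagVertex v a b))) := by
    intro ε hε v a b hv hs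
    rw [hB.even_angle v a b hv hs, mul_assoc, mul_assoc, ← rotZ_add, ← rotZ_add, ← hr0, ← hR0]
    congr 2
    linear_combination hδ ε hε v a b hv hs
  have Bangle' : ∀ ε, ∀ v a b, Even (v.1 + v.2) → HasSquare Q v a b →
      B (horVertex v a) v * rotZ (δ ε (horVertex v a) v) =
        B (horVertex v a) (diagVertex v a b) * rotZ (δ ε (horVertex v a) (diagVertex v a b)) *
          rotZ (((a * b : ℤˣ) : ℤ) * (π / 2)) := by
    intro ε v a b hv hs
    rw [hB.odd_angle v a b hv hs, δodd _ _ _ (odd_horVertex hv a),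
      δodd _ _ _ (odd_horVertex hv a), rotZ_zero, mul_one, mul_one]
  let T : ℝ → ℤ × ℤ → ℤ × ℤ → SO3 := fun ε => edgeTransport B (δ ε) (edgeLength (r ε) (R ε))
  have hT : ∀ ε ∈ I, IsFlat Q (T ε) := by
    intro ε hε
    refine isFlat_of_squares (fun u v h => ?_) fun v a b hv hs => ?_
    · simp only [T, edgeTransport]
      rw [edgeLength_comm _ _ h]
      have := halfTurn_mul_self (edgeLength (r ε) (R ε) u v)
      generalize halfTurn (edgeLength (r ε) (R ε) u v) = j at *
      have hj : j⁻¹ = j := inv_eq_of_mul_eq_one_right this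
      nth_rw 2 [← hj]
      group
    · have hw := even_diagVertex hv a b
      have m := hs.mem_ringVertices hv
      have m' := hs.diag.mem_ringVertices hw
      have l1 := edgeLength_hor (r ε) (R ε) a hv
      have l2 := edgeLength_ver (r ε) (R ε) b hv
      have l3 := edgeLength_ver (r ε) (R ε) (-b) hw
      have l4 := edgeLength_hor (r ε) (R ε) (-a) hw
      have e1 := Bangle ε hε v a b hv hs
      have e2 := Bangle ε hε _ _ _ hw hs.diag
      have e3 := Bangle' ε v a b hv hs
      have e4 := Bangle' ε _ _ _ hw hs.diag
      rw [horVertex_diagVertex, verVertex_diagVertex, diagVertex_diagVertex, neg_mul_neg] at e2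
      rw [horVertex_diagVertex, diagVertex_diagVertex, neg_mul_neg] at e4
      rw [verVertex_diagVertex, edgeLength_comm _ _ hs.adj_hor_diag] at l3
      rw [horVertex_diagVertex, edgeLength_comm _ _ hs.adj_ver_diag] at l4
      obtain ⟨q, hq⟩ := hq ε hε
      -- Both sides equal q cos r cos r', so the two triangles of the kite share their hypotenuse.
      have hcos : Real.cos (r ε v) * Real.cos (R ε (diagVertex v a b)) =
          Real.cos (R ε v) * Real.cos (r ε (diagVertex v a b)) := by
        rw [← hq _ m, ← hq _ m']; ring
      have K := kite_closes (hr ε hε _ m) (hR ε hε _ m) (hr ε hε _ m') (hR ε hε _ m') hcos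
        (unit_cast_mul a b)
      simp only [T, edgeTransport, l1, l2, l3, l4]
      rw [rotZ_neg, rotZ_neg] at K
      exact kite_transport_eq e1 e2 e3 e4 K
  obtain ⟨A, A0, Ac, hA⟩ := exists_potential hQ T I hT (fun u v h => by
    have hl := continuousOn_edgeLength hrc hRc h
    simp only [T, edgeTransport, mul_inv_rev, ← rotZ_neg]
    exact ((continuousOn_const.mul (continuous_rotZ.comp_continuousOn (δc u v))).mul
      (continuous_halfTurn.comp_continuousOn hl)).mul
      ((continuous_rotZ.comp_continuousOn (δc v u).neg).mul continuousOn_const)) (fun u v h => by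
    simp only [T, edgeTransport, δ0, rotZ_zero, hr0, hR0]
    rw [hBs u v h]; group)
  refine ⟨fun ε => C.displace (A ε) (r ε) (R ε), ?_, fun _ => rfl, fun _ => rfl, fun ε hε => ?_,
    fun v => (continuous_rotate_left _).comp_continuousOn (Ac v),
    fun v => (continuous_rotate_left _).comp_continuousOn (Ac v)⟩
  · ext1
    · funext v; simp only [Rings.displace, A0, rotate_one]
    · funext v; simp only [Rings.displace, A0, rotate_one]
    · exact hr0
    · exact hR0
  · have F : EdgeFrames Q (C.displace (A ε) (r ε) (R ε)) (r ε) (R ε)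
        (fun x y => A ε x * (B x y * rotZ (δ ε x y))) := by
      refine ⟨fun x y h => ⟨?_, ?_⟩, fun v a b hv hs => ?_, fun v a b hv hs => ?_⟩
      · rw [← mul_assoc, basePoint_mul_rotZ, C.position_displace, ← (hB.isFrame x y h).1,
          rotate_basePoint]
      · have e : A ε x * (B x y * rotZ (δ ε x y)) * halfTurn (edgeLength (r ε) (R ε) x y) =
            A ε y * (B y x * rotZ (δ ε y x)) := by
          rw [hA ε hε x y h]
          simp only [T, edgeTransport]
          group
        rw [e, ← mul_assoc, basePoint_mul_rotZ, C.position_displace,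
          ← (hB.isFrame y x h.symm).1, rotate_basePoint]
      · rw [Bangle ε hε v a b hv hs]; simp only [mul_assoc]
      · rw [Bangle' ε v a b hv hs]; simp only [mul_assoc]
    exact ⟨F.isRingPattern (hr ε hε) (hR ε hε) (hle ε hε) (hsum ε hε), fun v hv =>
      F.coneAngle_eq (hr ε hε) (hR ε hε) (even_of_mem_ringVertices hv)⟩

/-! ### The governing equations of circle patterns -/

theorem sqrt_one_sub_tanh_sq (x : ℝ) : √(1 - Real.tanh x ^ 2) = 1 / Real.cosh x := by
  have := Real.cosh_sq x
  have hc := Real.cosh_pos x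
  rw [Real.sqrt_eq_iff_mul_self_eq_of_pos (by positivity), Real.tanh_eq_sinh_div_cosh]
  field_simp
  linarith

theorem tanh_pos_of_pos {x : ℝ} (hx : 0 < x) : 0 < Real.tanh x := by
  rw [Real.tanh_eq_sinh_div_cosh]
  exact div_pos (Real.sinh_pos_iff.2 hx) (Real.cosh_pos x)

/-- Both sides vanish at y = 0 and have the same derivative in y, by cosh(x + y) cosh(x - y) = cosh²
x + sinh² y. -/
theorem arctan_sinh_add_sub (x y : ℝ) :
    Real.arctan (Real.sinh (x + y)) - Real.arctan (Real.sinh (x - y)) =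
      2 * Real.arctan (Real.sinh y / Real.cosh x) := by
  have hx := Real.cosh_pos x
  let f : ℝ → ℝ := fun y => Real.arctan (Real.sinh (x + y)) - Real.arctan (Real.sinh (x - y)) -
    2 * Real.arctan (Real.sinh y / Real.cosh x)
  have hf : ∀ y, HasDerivAt f 0 y := fun y => by
    have h1 := ((hasDerivAt_id y).const_add x).sinh.arctan
    have h2 := ((hasDerivAt_id y).const_sub x).sinh.arctan
    have h3 := (((Real.hasDerivAt_sinh y).div_const (Real.cosh x)).arctan).const_mul 2
    refine ((h1.sub h2).sub h3).congr_deriv ?_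
    have c1 := Real.cosh_pos (x + y)
    have c2 := Real.cosh_pos (x - y)
    have k : 1 + (Real.sinh y / Real.cosh x) ^ 2 =
        Real.cosh (x + y) * Real.cosh (x - y) / Real.cosh x ^ 2 := by
      rw [Real.cosh_add, Real.cosh_sub]
      field_simp
      linear_combination -Real.cosh x ^ 2 * Real.cosh_sq y - Real.sinh y ^ 2 * Real.cosh_sq x
    rw [k]
    simp only [id, ← Real.cosh_sq']
    field_simp
    rw [Real.cosh_add, Real.cosh_sub]
    ring
  have h := is_const_of_deriv_eq_zero (fun y => (hf y).differentiableAt)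
    (fun y => (hf y).deriv) y 0
  simp [f] at h
  linarith

theorem legAngle_arccos_tanh {x y : ℝ} (hy : 0 < y) :
    legAngle (Real.arccos (Real.tanh x)) (Real.arccos (Real.tanh y)) =
      Real.arctan (Real.cosh x / Real.sinh y) := by
  have := Real.cosh_pos x
  have := Real.cosh_pos y
  have := Real.sinh_pos_iff.2 hy
  rw [legAngle, Real.tan_arccos, Real.sin_arccos, sqrt_one_sub_tanh_sq, sqrt_one_sub_tanh_sq,
    Real.tanh_eq_sinh_div_cosh]
  congr 1
  field_simp

/-- The link between geometry and functional: the kite angle is π plus the derivative of F(x - y) -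
F(x + y) in x. Positivity of y enters through arctan(1/t) = π/2 - arctan t. -/
theorem kiteAngle_arccos_tanh {x y : ℝ} (hy : 0 < y) :
    kiteAngle (Real.arccos (Real.tanh x)) (Real.arccos (Real.tanh x)) (Real.arccos (Real.tanh y))
      (Real.arccos (Real.tanh y)) =
      π + Real.arctan (Real.sinh (x - y)) - Real.arctan (Real.sinh (x + y)) := by
  have h := arctan_sinh_add_sub x y
  have := Real.arctan_inv_of_pos (div_pos (Real.sinh_pos_iff.2 hy) (Real.cosh_pos x))
  rw [inv_div] at this
  rw [kiteAngle, legAngle_arccos_tanh hy, this]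
  linarith

theorem hasDerivAt_circleF (x : ℝ) : HasDerivAt circleF (Real.arctan (Real.sinh x)) x := by
  have hc := Real.continuous_arctan.comp Real.continuous_sinh
  exact intervalIntegral.integral_hasDerivAt_right (hc.intervalIntegrable _ _)
    (hc.stronglyMeasurableAtFilter _ _) hc.continuousAt

/-- The contribution of a pair of neighbours to the governing equation. -/
def bondForce (x y : ℝ) : ℝ := Real.arctan (Real.sinh (x - y)) - Real.arctan (Real.sinh (x + y))

theorem hasDerivAt_update (β : ℤ × ℤ → ℝ) (i v : ℤ × ℤ) :
    HasDerivAt (fun t => Function.update β i t v) (if v = i then 1 else 0) (β i) := by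
  by_cases hv : v = i
  · subst hv
    simpa using hasDerivAt_id' (β v)
  · simpa [hv] using hasDerivAt_const (β i) (β v)

/-- Since F' is odd, the term of a pair of neighbours contributes in the same form at either end. -/
theorem hasDerivAt_bond (i e e' : ℤ × ℤ) (h : e ≠ e') (β : ℤ × ℤ → ℝ) :
    HasDerivAt (fun t => circleF (Function.update β i t e - Function.update β i t e') -
        circleF (Function.update β i t e + Function.update β i t e'))
      ((if e = i then bondForce (β i) (β e') else 0) +
        if e' = i then bondForce (β i) (β e) else 0) (β i) := by
  have d1 := hasDerivAt_update β i e
  have d2 := hasDerivAt_update β i e'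
  have c1 := (hasDerivAt_circleF _).comp (β i) (d1.sub d2)
  have c2 := (hasDerivAt_circleF _).comp (β i) (d1.add d2)
  refine (c1.sub c2).congr_deriv ?_
  simp only [Pi.add_apply, Pi.sub_apply, Function.update_eq_self, bondForce]
  by_cases h1 : e = i
  · subst h1
    simp [h.symm]
  · by_cases h2 : e' = i
    · subst h2
      simp only [h1, if_false, if_true]
      rw [← neg_sub (β e') (β e), Real.sinh_neg, Real.arctan_neg, add_comm (β e)]
      ring
    · simp [h1, h2]

/-- Translates sums over squares, as in the functional, into sums over directions at an even vertex,
as in the cone angle. The parity of s decides which diagonal carries rings. -/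
theorem sum_directions_eq (i s : ℤ × ℤ) (hi : Even (i.1 + i.2)) (k : ℤ × ℤ → ℝ) :
    (∑ d : ℤˣ × ℤˣ, if s = (min i.1 (i.1 + d.1), min i.2 (i.2 + d.2)) then
        k (diagVertex i d.1 d.2) else 0) =
      (if (edgeEnds s).1 = i then k (edgeEnds s).2 else 0) +
        if (edgeEnds s).2 = i then k (edgeEnds s).1 else 0 := by
  obtain ⟨x, y⟩ := i
  obtain ⟨m, n⟩ := s
  have hu : (Finset.univ : Finset ℤˣ) = {1, -1} := rfl
  simp only [Fintype.sum_prod_type, hu]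
  rw [Finset.sum_pair (by decide), Finset.sum_pair (by decide), Finset.sum_pair (by decide)]
  simp only at hi
  by_cases hs : Even (m + n)
  · have h1 : ¬ (m = x ∧ n = y + -1) := by rintro ⟨rfl, rfl⟩; grind
    have h2 : ¬ (m = x + -1 ∧ n = y) := by rintro ⟨rfl, rfl⟩; grind
    have h3 : (m + 1 = x ∧ n + 1 = y) ↔ (m = x + -1 ∧ n = y + -1) := by omega
    simp [edgeEnds, hs, diagVertex, h1, h2, h3]
    congr 1 <;> split_ifs with h
    · rw [h.1, h.2]
    · rfl
    · rw [h.1, h.2]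
    · rfl
  · have h1 : ¬ (m = x ∧ n = y) := by rintro ⟨rfl, rfl⟩; exact hs hi
    have h2 : ¬ (m = x + -1 ∧ n = y + -1) := by rintro ⟨rfl, rfl⟩; grind
    have h3 : (m + 1 = x ∧ n = y) ↔ (m = x + -1 ∧ n = y) := by omega
    have h4 : (m = x ∧ n + 1 = y) ↔ (m = x ∧ n = y + -1) := by omega
    simp [edgeEnds, hs, diagVertex, h1, h2, h3, h4]
    rw [add_comm]
    congr 1 <;> split_ifs with h
    · rw [h.1, h.2]
    · rfl
    · rw [h.1, h.2]
    · rfl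

theorem edgeEnds_ne (s : ℤ × ℤ) : (edgeEnds s).1 ≠ (edgeEnds s).2 := by
  unfold edgeEnds
  split_ifs <;> simp [Prod.ext_iff]

theorem hasDerivAt_functional (B : BoundaryProblem) (Q : SquareComplex) {i : ℤ × ℤ}
    (hi : i ∈ ringVertices Q) (β : ℤ × ℤ → ℝ) :
    HasDerivAt (fun t => B.functional Q (Function.update β i t))
      ((∑ d : ℤˣ × ℤˣ, if HasSquare Q i d.1 d.2 then
        bondForce (β i) (β (diagVertex i d.1 d.2)) else 0) + B.phi Q i) (β i) := by
  unfold BoundaryProblem.functional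
  refine HasDerivAt.add ?_ ?_
  · refine (HasDerivAt.fun_sum fun s _ => hasDerivAt_bond i _ _ (edgeEnds_ne s) β).congr_deriv ?_
    simp only [← sum_directions_eq i _ (even_of_mem_ringVertices hi) fun v => bondForce (β i) (β v)]
    rw [Finset.sum_comm]
    refine Finset.sum_congr rfl fun d _ => ?_
    rw [Finset.sum_ite_eq' Q]
    rfl
  · refine (HasDerivAt.fun_sum fun v _ => (hasDerivAt_update β i v).const_mul (B.phi Q v)
      ).congr_deriv ?_
    simp only [mul_ite, mul_one, mul_zero]
    rw [Finset.sum_ite_eq' (ringVertices Q), if_pos hi]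

/-- The left side of the governing equation is the difference of the cone angle and its prescribed
value. -/
theorem governing_eq (B : BoundaryProblem) (Q : SquareComplex) {i : ℤ × ℤ}
    (hi : i ∈ ringVertices Q) {β : ℤ × ℤ → ℝ} (hβ : ∀ v ∈ ringVertices Q, 0 < β v) :
    B.governing Q i β = kiteSum Q (fun v => Real.arccos (Real.tanh (β v)))
      (fun v => Real.arccos (Real.tanh (β v))) i - (π * valence Q i - B.phi Q i) := by
  rw [BoundaryProblem.governing, (hasDerivAt_functional B Q hi β).deriv]
  have e : (valence Q i : ℝ) = ∑ d : ℤˣ × ℤˣ, if HasSquare Q i d.1 d.2 then 1 else 0 := by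
    simp [valence]
  rw [e, Finset.mul_sum, kiteSum, sub_sub_eq_add_sub, ← sub_add_eq_add_sub,
    ← Finset.sum_sub_distrib]
  congr 1
  refine Finset.sum_congr rfl fun d _ => ?_
  split_ifs with hs
  · rw [kiteAngle_arccos_tanh (hβ _ (hs.diag.mem_ringVertices
      (even_diagVertex (even_of_mem_ringVertices hi) _ _))), bondForce]
    ring
  · simp

/-! ### Continuation of the solution -/

/-- The inner radius with variable `x`. -/
def innerRadius (x : ℝ) : ℝ := Real.arccos (Real.tanh x)

/-- The outer radius with variable `x` in a pattern with parameter `q`. -/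
def outerRadius (q x : ℝ) : ℝ := Real.arccos (q * Real.tanh x)

theorem outerRadius_one (x : ℝ) : outerRadius 1 x = innerRadius x := by
  rw [outerRadius, one_mul, innerRadius]

theorem innerRadius_mem {x : ℝ} (hx : 0 < x) : innerRadius x ∈ Set.Ioo 0 (π / 2) :=
  ⟨Real.arccos_pos.2 (Real.tanh_lt_one x), Real.arccos_lt_pi_div_two.2 (tanh_pos_of_pos hx)⟩

theorem outerRadius_mem {q x : ℝ} (hq : q ∈ Set.Ioc 0 1) (hx : 0 < x) :
    outerRadius q x ∈ Set.Ioo 0 (π / 2) := by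
  have h1 := Real.tanh_lt_one x
  have h2 := tanh_pos_of_pos hx
  exact ⟨Real.arccos_pos.2 (by nlinarith [hq.1, hq.2]),
    Real.arccos_lt_pi_div_two.2 (mul_pos hq.1 h2)⟩

theorem innerRadius_le_outerRadius {q x : ℝ} (hq : q ∈ Set.Ioc 0 1) (hx : 0 < x) :
    innerRadius x ≤ outerRadius q x := by
  have h2 := tanh_pos_of_pos hx
  exact Real.arccos_le_arccos (by nlinarith [hq.2])

theorem cos_outerRadius {q x : ℝ} (hq : q ∈ Set.Ioc 0 1) :
    q * Real.cos (innerRadius x) = Real.cos (outerRadius q x) := by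
  have h1 := abs_lt.1 (Real.abs_tanh_lt_one x)
  rw [innerRadius, outerRadius, Real.cos_arccos h1.1.le h1.2.le, Real.cos_arccos] <;>
    nlinarith [hq.1, hq.2]

theorem contDiff_tanh : ContDiff ℝ 1 Real.tanh := by
  have : Real.tanh = fun x => Real.sinh x / Real.cosh x := funext Real.tanh_eq_sinh_div_cosh
  rw [this]
  exact Real.contDiff_sinh.div Real.contDiff_cosh fun x => (Real.cosh_pos x).ne'

/-- Since |tanh x| < 1, the argument of arccos stays inside (-1, 1) even at q = 1. So q = 1 is an
interior point for the inverse function theorem, although only q ≤ 1 has a geometric meaning. -/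
theorem contDiffAt_outerRadius {E : Type*} [NormedAddCommGroup E] [NormedSpace ℝ E] {q x : E → ℝ}
    {p : E} (hq : ContDiffAt ℝ 1 q p) (hx : ContDiffAt ℝ 1 x p) (h1 : q p ∈ Set.Ioc 0 1) :
    ContDiffAt ℝ 1 (fun p => outerRadius (q p) (x p)) p := by
  have h2 := abs_lt.1 (Real.abs_tanh_lt_one (x p))
  exact (Real.contDiffAt_arccos (x := q p * Real.tanh (x p)) (by nlinarith [h1.1, h1.2])
    (by nlinarith [h1.1, h1.2])).comp p (hq.mul (contDiff_tanh.contDiffAt.comp p hx))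

theorem contDiffAt_innerRadius {E : Type*} [NormedAddCommGroup E] [NormedSpace ℝ E] {x : E → ℝ}
    {p : E} (hx : ContDiffAt ℝ 1 x p) : ContDiffAt ℝ 1 (fun p => innerRadius (x p)) p := by
  simpa only [outerRadius_one] using
    contDiffAt_outerRadius (q := fun _ => 1) contDiffAt_const hx (by norm_num)

theorem contDiffAt_legAngle {E : Type*} [NormedAddCommGroup E] [NormedSpace ℝ E] {a b : E → ℝ}
    {p : E} (ha : ContDiffAt ℝ 1 a p) (hb : ContDiffAt ℝ 1 b p) (ha' : a p ∈ Set.Ioo 0 (π / 2))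
    (hb' : b p ∈ Set.Ioo 0 (π / 2)) : ContDiffAt ℝ 1 (fun p => legAngle (a p) (b p)) p :=
  (((Real.contDiffAt_tan.2 (cos_pos_of_acute hb').ne').comp p hb).div
    (Real.contDiff_sin.contDiffAt.comp p ha) (sin_pos_of_acute ha').ne').arctan

theorem contDiffAt_kiteSum {E : Type*} [NormedAddCommGroup E] [NormedSpace ℝ E] (Q : SquareComplex)
    {q : E → ℝ} {β : E → ℤ × ℤ → ℝ} {p : E} (hq : ContDiffAt ℝ 1 q p)
    (hβ : ∀ v ∈ ringVertices Q, ContDiffAt ℝ 1 (fun p => β p v) p) (hq' : q p ∈ Set.Ioc 0 1)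
    (hβ' : ∀ v ∈ ringVertices Q, 0 < β p v) {v : ℤ × ℤ} (hv : v ∈ ringVertices Q) :
    ContDiffAt ℝ 1 (fun p => kiteSum Q (fun v => innerRadius (β p v))
      (fun v => outerRadius (q p) (β p v)) v) p := by
  unfold kiteSum
  refine ContDiffAt.sum fun d _ => ?_
  split_ifs with hs
  · have hw := hs.diag.mem_ringVertices (even_diagVertex (even_of_mem_ringVertices hv) _ _)
    exact (contDiffAt_legAngle (contDiffAt_innerRadius (hβ _ hv))
      (contDiffAt_outerRadius hq (hβ _ hw) hq') (innerRadius_mem (hβ' _ hv))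
      (outerRadius_mem hq' (hβ' _ hw))).add
      (contDiffAt_legAngle (contDiffAt_outerRadius hq (hβ _ hv) hq')
      (contDiffAt_innerRadius (hβ _ hw)) (outerRadius_mem hq' (hβ' _ hv))
      (innerRadius_mem (hβ' _ hw)))
  · exact contDiffAt_const

/-- A `C¹` map with injective derivative has a continuous local solution of `f x = y` along every
continuous curve `y`. -/
theorem exists_lift_of_injective_fderiv {E : Type*} [NormedAddCommGroup E] [NormedSpace ℝ E]
    [FiniteDimensional ℝ E] {f : E → E} {p : E} (hf : ContDiffAt ℝ 1 f p)
    (hinj : ∀ x, fderiv ℝ f p x = 0 → x = 0) {y : ℝ → E} {ε₁ : ℝ} (hε₁ : 0 < ε₁)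
    (hy : ContinuousOn y (Set.Ico 0 ε₁)) (hy0 : y 0 = f p) {U : Set E} (hU : U ∈ 𝓝 p) :
    ∃ δ ∈ Set.Ioc 0 ε₁, ∃ x : ℝ → E, x 0 = p ∧ ContinuousOn x (Set.Ico 0 δ) ∧
      ∀ ε ∈ Set.Ico 0 δ, f (x ε) = y ε ∧ x ε ∈ U := by
  have : CompleteSpace E := FiniteDimensional.complete ℝ E
  -- In finite dimension an injective endomorphism is invertible.
  let L : E ≃L[ℝ] E := (LinearEquiv.ofInjectiveEndo (fderiv ℝ f p : E →ₗ[ℝ] E)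
    ((injective_iff_map_eq_zero _).2 hinj)).toContinuousLinearEquiv
  have hL : HasStrictFDerivAt f (L : E →L[ℝ] E) p := by
    convert hf.hasStrictFDerivAt (by norm_num)
    ext x
    rfl
  let Φ := hL.toOpenPartialHomeomorph
  have hps : p ∈ Φ.source := hL.mem_toOpenPartialHomeomorph_source
  have hpt : f p ∈ Φ.target := hL.image_mem_toOpenPartialHomeomorph_target
  have e0 : Φ.symm (f p) = p := Φ.left_inv hps
  have hev : ∀ᶠ z in 𝓝 (f p), z ∈ Φ.target ∧ Φ.symm z ∈ U := by
    refine Filter.Eventually.and (Φ.open_target.mem_nhds hpt) ?_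
    have := Φ.continuousAt_symm hpt
    rw [ContinuousAt, e0] at this
    exact this hU
  have hev' : ∀ᶠ ε in 𝓝[Set.Ico 0 ε₁] 0, y ε ∈ Φ.target ∧ Φ.symm (y ε) ∈ U := by
    have := hy 0 ⟨le_rfl, hε₁⟩
    rw [ContinuousWithinAt, hy0] at this
    exact this hev
  obtain ⟨δ, hδ, hb⟩ := Metric.mem_nhdsWithin_iff.1 hev'
  have hin : ∀ ε ∈ Set.Ico 0 (min δ ε₁), y ε ∈ Φ.target ∧ Φ.symm (y ε) ∈ U := by
    rintro ε ⟨h1, h2⟩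
    rw [lt_min_iff] at h2
    exact hb ⟨by rw [Metric.mem_ball, Real.dist_0_eq_abs, abs_of_nonneg h1]; exact h2.1, h1, h2.2⟩
  refine ⟨min δ ε₁, ⟨lt_min hδ hε₁, min_le_right _ _⟩, fun ε => Φ.symm (y ε),
    by simp only [hy0, e0], ?_, fun ε hε => ⟨Φ.right_inv (hin ε hε).1, (hin ε hε).2⟩⟩
  exact Φ.continuousOn_symm.comp (hy.mono fun ε hε => ⟨hε.1, hε.2.trans_le (min_le_right _ _)⟩)
    fun ε hε => (hin ε hε).1

theorem freeRings_subset (B : BoundaryProblem) (Q : SquareComplex) :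
    B.freeRings Q ⊆ ringVertices Q := by
  cases B with
  | dirichlet b => exact Finset.filter_subset _ _
  | neumann Θ => exact subset_rfl

theorem tanh_uniformizer_one {R : ℝ} (hR : R ∈ Set.Ioo 0 (π / 2)) :
    Real.tanh (uniformizer 1 R) = Real.cos R := by
  have s := Real.sin_pos_of_pos_of_lt_pi (x := R / 2) (by linarith [hR.1])
    (by linarith [hR.2, Real.pi_pos])
  have c := Real.cos_pos_of_mem_Ioo (x := R / 2)
    ⟨by linarith [hR.1, Real.pi_pos], by linarith [hR.2, Real.pi_pos]⟩
  rw [uniformizer_one hR.1 (by linarith [hR.2, Real.pi_pos]), Real.cot_eq_cos_div_sin,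
    Real.tanh_eq_sinh_div_cosh, Real.sinh_eq, Real.cosh_eq, Real.exp_neg,
    Real.exp_log (div_pos c s)]
  have h := Real.sin_sq_add_cos_sq (R / 2)
  have e : Real.cos R = 2 * Real.cos (R / 2) ^ 2 - 1 := by
    rw [← Real.cos_two_mul]; congr 1; ring
  rw [e]
  field_simp
  linear_combination (-2 * Real.cos (R / 2) ^ 2) * h

theorem innerRadius_uniformizer {R : ℝ} (hR : R ∈ Set.Ioo 0 (π / 2)) :
    innerRadius (uniformizer 1 R) = R := by
  rw [innerRadius, tanh_uniformizer_one hR,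
    Real.arccos_cos hR.1.le (by linarith [hR.2, Real.pi_pos])]

theorem uniformizer_pos {R : ℝ} (hR : R ∈ Set.Ioo 0 (π / 2)) : 0 < uniformizer 1 R := by
  have h := cos_pos_of_acute hR
  rw [← tanh_uniformizer_one hR, Real.tanh_eq_sinh_div_cosh] at h
  exact Real.sinh_pos_iff.1 ((div_pos_iff_of_pos_right (Real.cosh_pos _)).1 h)

theorem kiteSum_congr {Q : SquareComplex} {r R r' R' : ℤ × ℤ → ℝ}
    (hr : ∀ v ∈ ringVertices Q, r v = r' v)
    (hR : ∀ v ∈ ringVertices Q, R v = R' v) {v : ℤ × ℤ} (hv : v ∈ ringVertices Q) :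
    kiteSum Q r R v = kiteSum Q r' R' v := by
  unfold kiteSum
  refine Finset.sum_congr rfl fun d _ => ?_
  split_ifs with hs
  · have hw := hs.diag.mem_ringVertices (even_diagVertex (even_of_mem_ringVertices hv) _ _)
    rw [hr v hv, hR v hv, hr _ hw, hR _ hw]
  · rfl

/-- The circle pattern satisfies the governing equations. At inner rings the right side is 4π - 2π.
-/
theorem IsCirclePattern.kiteSum_eq {Q : SquareComplex} {B : BoundaryProblem} {C : Rings}
    (hC : IsCirclePattern Q C) (hB : B.Holds Q C 1) {v : ℤ × ℤ} (hv : v ∈ B.freeRings Q) :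
    kiteSum Q C.r C.R v = π * valence Q v - B.phi Q v := by
  have m := freeRings_subset B Q hv
  rw [← hC.coneAngle_eq m]
  unfold BoundaryProblem.phi
  by_cases hin : v ∈ innerRings Q
  · have hval : valence Q v = 4 := (Finset.mem_filter.1 hin).2
    have hr := (hC.radius_mem m).1
    rw [if_pos hin, hC.1.closing v hin, hC.2 v m, sign_pos hr, hval]
    simp
    ring
  · rw [if_neg hin]
    cases B with
    | dirichlet b => exact absurd hv hin
    | neumann Θ =>
      have hlt : valence Q v < 4 := by
        refine lt_of_le_of_ne ((Finset.card_filter_le _ _).trans (by rfl)) fun h => hin ?_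
        exact Finset.mem_filter.2 ⟨m, h⟩
      have := hB v (Finset.mem_filter.2 ⟨m, hlt⟩)
      simp only [this]
      ring

/-- A rigid circle pattern can be continued: for small `ε` there are variables, with prescribed
values at the rings that are not free, for which the cone angles of the free rings do not change. -/
theorem exists_variables {Q : SquareComplex} {B : BoundaryProblem} {C : Rings}
    (hC : IsCirclePattern Q C) (hB : B.Holds Q C 1) (hrigid : B.Rigid Q C) {ε₁ : ℝ} (hε₁ : 0 < ε₁)
    {ξ : ℝ → ℤ × ℤ → ℝ} (hξ : ∀ v ∈ ringVertices Q, ContinuousOn (fun ε => ξ ε v) (Set.Ico 0 ε₁))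
    (hξ0 : ∀ v ∈ ringVertices Q, ξ 0 v = uniformizer 1 (C.R v)) :
    ∃ δ ∈ Set.Ioc 0 ε₁, ∃ β : ℝ → ℤ × ℤ → ℝ, (∀ v, β 0 v = uniformizer 1 (C.R v)) ∧
      (∀ v ∈ ringVertices Q, ContinuousOn (fun ε => β ε v) (Set.Ico 0 δ)) ∧
      ∀ ε ∈ Set.Ico 0 δ, (∀ v ∈ ringVertices Q, 0 < β ε v) ∧
        (∀ v ∈ B.freeRings Q, kiteSum Q (fun v => innerRadius (β ε v))
          (fun v => outerRadius (1 - ε) (β ε v)) v = π * valence Q v - B.phi Q v) ∧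
        ∀ v ∈ ringVertices Q, v ∉ B.freeRings Q → β ε v = ξ ε v := by
  classical
  set β₀ : ℤ × ℤ → ℝ := fun v => uniformizer 1 (C.R v) with hβ₀
  have β₀pos : ∀ v ∈ ringVertices Q, 0 < β₀ v := fun v hv => uniformizer_pos (hC.radius_mem hv)
  let X := {v // v ∈ ringVertices Q} → ℝ
  -- Only the finitely many variables at ring vertices move; elsewhere the initial values are kept.
  let ext : X → ℤ × ℤ → ℝ := fun x v => if h : v ∈ ringVertices Q then x ⟨v, h⟩ else β₀ v
  let x₀ : X := fun v => β₀ v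
  have ext0 : ext x₀ = β₀ := funext fun v => by simp only [ext, x₀, dite_eq_ite, ite_self]
  let G : ℝ × X → ℤ × ℤ → ℝ := fun p v => kiteSum Q (fun v => innerRadius (ext p.2 v))
    (fun v => outerRadius p.1 (ext p.2 v)) v
  -- Keeping q and the variables that are not free as components makes this a map between spaces of
  -- equal dimension.
  let H : ℝ × X → ℝ × X := fun p =>
    (p.1, fun v => if v.1 ∈ B.freeRings Q then G p v.1 else p.2 v)
  have hHG : ∀ v ∈ ringVertices Q, ContDiffAt ℝ 1 (fun p => G p v) (1, x₀) := fun v hv => by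
    refine contDiffAt_kiteSum Q contDiffAt_fst (fun w hw => ?_) (by norm_num) (fun w hw => ?_) hv
    · simp only [ext, hw, dif_pos]
      fun_prop
    · rw [ext0]; exact β₀pos w hw
  have hH : ContDiffAt ℝ 1 H (1, x₀) := by
    refine contDiffAt_fst.prodMk (contDiffAt_pi.2 fun v => ?_)
    by_cases hv : v.1 ∈ B.freeRings Q
    · simpa only [hv, if_true] using hHG v.1 v.2
    · simp only [hv, if_false]
      fun_prop
  have hG0 : ∀ v ∈ B.freeRings Q, G (1, x₀) v = π * valence Q v - B.phi Q v := fun v hv => by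
    rw [← hC.kiteSum_eq hB hv]
    refine kiteSum_congr (fun w hw => ?_) (fun w hw => ?_) (freeRings_subset B Q hv)
    · rw [ext0, innerRadius_uniformizer (hC.radius_mem hw), hC.2 w hw]
    · rw [ext0, outerRadius_one, innerRadius_uniformizer (hC.radius_mem hw)]
  have hinj : ∀ z, fderiv ℝ H (1, x₀) z = 0 → z = 0 := by
    rintro ⟨dq, dx⟩ hz
    have hd := (hH.differentiableAt (by norm_num)).hasFDerivAt
    -- Rigidity speaks of lines β + t φ, so the derivative of `H` is tested along a line.
    have hc : HasDerivAt (fun t : ℝ => ((1 + t * dq, fun v => x₀ v + t * dx v) : ℝ × X)) (dq, dx) 0 :=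
      ((hasDerivAt_mul_const dq).const_add 1).prodMk
        (hasDerivAt_pi.2 fun v => (hasDerivAt_mul_const (dx v)).const_add (x₀ v))
    have hc0 : ((1 + 0 * dq, fun v => x₀ v + 0 * dx v) : ℝ × X) = (1, x₀) := by
      simp
    have hHc := (hc0 ▸ hd : HasFDerivAt H _ (1 + 0 * dq, fun v => x₀ v + 0 * dx v)).comp_hasDerivAt
      (0 : ℝ) hc
    rw [hc0, hz] at hHc
    have hdq : dq = 0 := ((hasDerivAt_mul_const dq).const_add 1).unique hHc.fst
    subst hdq
    have hv : ∀ i : {v // v ∈ ringVertices Q}, HasDerivAt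
        (fun t : ℝ => (H (1 + t * 0, fun v => x₀ v + t * dx v)).2 i) 0 0 := hasDerivAt_pi.1 hHc.snd
    let φ : ℤ × ℤ → ℝ := fun v => if h : v ∈ ringVertices Q then dx ⟨v, h⟩ else 0
    have hext : ∀ t : ℝ, ext (fun v => x₀ v + t * dx v) = fun v => β₀ v + t * φ v := fun t => by
      funext v
      by_cases h : v ∈ ringVertices Q <;> simp [ext, φ, h, x₀]
    -- A kernel vector has dq = 0, vanishes at the rings that are not free, and changes the angle
    -- sums at the free rings by o(t) only; so it is an infinitesimal deformation.
    have hφ : φ = 0 := by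
      refine hrigid φ ⟨fun v hf => ?_, fun i hi => ?_⟩
      · by_cases h : v ∈ ringVertices Q
        · simp only [φ, h, dif_pos]
          have := hv ⟨v, h⟩
          simp only [H, hf, if_false] at this
          exact ((hasDerivAt_mul_const _).const_add _).unique this
        · simp only [φ, h, dif_neg, not_false_iff]
      · have hir := freeRings_subset B Q hi
        have := hv ⟨i, hir⟩
        simp only [H, hi, if_true, mul_zero, add_zero] at this
        have ho := this.isLittleO
        simp only [sub_zero, smul_zero] at ho
        refine ho.congr' ?_ (by rfl)
        -- The governing equation equals the angle defect only where all variables are positive,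
        -- which holds for small t.
        have hpos : ∀ᶠ t : ℝ in 𝓝 0, ∀ v ∈ ringVertices Q, 0 < β₀ v + t * φ v := by
          refine (Filter.eventually_all_finset _).2 fun v hv => ?_
          have hcont : ContinuousAt (fun t : ℝ => β₀ v + t * φ v) 0 := by fun_prop
          exact hcont.eventually_const_lt (by simpa using β₀pos v hv)
        filter_upwards [hpos] with t ht
        rw [governing_eq B Q hir ht, ← hG0 i hi]
        simp only [G, hext, ext0, outerRadius_one]
        simp only [zero_mul, add_zero]
        rfl
    refine Prod.ext rfl (funext fun v => ?_)
    have := congrFun hφ v.1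
    simp only [φ, v.2, dif_pos] at this
    exact this
  let y : ℝ → ℝ × X := fun ε => (1 - ε, fun v => if v.1 ∈ B.freeRings Q then
    π * valence Q v - B.phi Q v else ξ ε v)
  have hy : ContinuousOn y (Set.Ico 0 ε₁) := by
    refine ContinuousOn.prodMk (by fun_prop) (continuousOn_pi.2 fun v => ?_)
    by_cases hv : v.1 ∈ B.freeRings Q
    · simpa only [hv, if_true] using continuousOn_const
    · simpa only [hv, if_false] using hξ v.1 v.2
  have hy0 : y 0 = H (1, x₀) := by
    refine Prod.ext (by simp [y, H]) (funext fun v => ?_)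
    by_cases hv : v.1 ∈ B.freeRings Q
    · simp only [y, H, hv, if_true, hG0 v.1 hv]
    · simp only [y, H, hv, if_false, hξ0 v.1 v.2, x₀, hβ₀]
  have hU : {p : ℝ × X | ∀ v, 0 < p.2 v} ∈ 𝓝 ((1, x₀) : ℝ × X) := by
    have : IsOpen {p : ℝ × X | ∀ v, 0 < p.2 v} := by
      simp only [Set.ofPred_forall]
      exact isOpen_iInter_of_finite fun v => isOpen_lt continuous_const (by fun_prop)
    exact this.mem_nhds fun v => β₀pos v.1 v.2
  obtain ⟨δ, hδ, x, hx0, hxc, hx⟩ := exists_lift_of_injective_fderiv hH hinj hε₁ hy hy0 hU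
  refine ⟨δ, hδ, fun ε => ext (x ε).2, fun v => ?_, fun v hv => ?_, fun ε hε => ?_⟩
  · simp only [hx0, ext0, hβ₀]
  · simp only [ext, hv, dif_pos]
    exact (continuous_apply _).comp_continuousOn (continuous_snd.comp_continuousOn hxc)
  · obtain ⟨h1, h2⟩ := hx ε hε
    have hq : (x ε).1 = 1 - ε := congrArg Prod.fst h1
    have hv' : ∀ v : {v // v ∈ ringVertices Q}, (H (x ε)).2 v = (y ε).2 v :=
      fun v => by rw [h1]
    refine ⟨fun v hv => ?_, fun v hv => ?_, fun v hv hf => ?_⟩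
    · simp only [ext, hv, dif_pos]
      exact h2 ⟨v, hv⟩
    · have := hv' ⟨v, freeRings_subset B Q hv⟩
      simpa only [H, y, G, hv, if_true, hq] using this
    · have := hv' ⟨v, hv⟩
      simpa only [H, y, hf, if_false, ext, hv, dif_pos] using this

/-! ### Prescribed variables -/

theorem strictMono_tanh : StrictMono Real.tanh := fun x y h => by
  rwa [← Real.artanh_lt_artanh_iff ⟨Real.neg_one_lt_tanh x, Real.tanh_lt_one x⟩
    ⟨Real.neg_one_lt_tanh y, Real.tanh_lt_one y⟩, Real.artanh_tanh, Real.artanh_tanh]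

/-- The root of a family of strictly increasing functions depends continuously on the parameter. -/
theorem exists_continuous_root {f : ℝ → ℝ → ℝ} (hf : Continuous f.uncurry)
    (hmono : ∀ ε, StrictMono (f ε)) {a b x₀ : ℝ} (ha : a < x₀) (hb : x₀ < b) :
    ∃ δ > 0, ∃ g : ℝ → ℝ, g 0 = x₀ ∧ ContinuousOn g (Set.Ico 0 δ) ∧
      ∀ ε ∈ Set.Ico 0 δ, f ε (g ε) = f 0 x₀ ∧ g ε ∈ Set.Ioo a b := by
  have hc : ∀ x, Continuous fun ε => f ε x := fun x =>
    hf.comp (by fun_prop : Continuous fun ε => (ε, x))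
  have hev : ∀ᶠ ε in 𝓝 (0 : ℝ), f ε a < f 0 x₀ ∧ f 0 x₀ < f ε b :=
    ((hc a).continuousAt.eventually_lt_const (hmono 0 ha)).and
      ((hc b).continuousAt.eventually_const_lt (hmono 0 hb))
  obtain ⟨δ, hδ, hball⟩ := Metric.eventually_nhds_iff.1 hev
  have hroot : ∀ ε, ∃ x, ε ∈ Set.Ico 0 δ → f ε x = f 0 x₀ ∧ x ∈ Set.Ioo a b := fun ε => by
    by_cases hε : ε ∈ Set.Ico 0 δ
    · obtain ⟨h1, h2⟩ := hball (y := ε) (by rw [Real.dist_0_eq_abs, abs_of_nonneg hε.1]; exact hε.2)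
      obtain ⟨x, hx, e⟩ := intermediate_value_Ioo (ha.trans hb).le
        (hf.comp (by fun_prop : Continuous fun x => (ε, x))).continuousOn ⟨h1, h2⟩
      exact ⟨x, fun _ => ⟨e, hx⟩⟩
    · exact ⟨0, fun h => absurd h hε⟩
  choose g hg using hroot
  refine ⟨δ, hδ, g, (hmono 0).injective (hg 0 ⟨le_rfl, hδ⟩).1, fun ε hε => ?_, hg⟩
  obtain ⟨h1, h2⟩ := hg ε hε
  -- The strict inequality between the value at c and the common level persists for nearby
  -- parameters, and monotonicity turns it back into an inequality between c and the root.
  refine tendsto_order.2 ⟨fun c hcg => ?_, fun c hcg => ?_⟩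
  · have : f ε c < f 0 x₀ := by rw [← h1]; exact hmono ε hcg
    filter_upwards [mem_nhdsWithin_of_mem_nhds ((hc c).continuousAt.eventually_lt_const this),
      self_mem_nhdsWithin] with ε' h3 h4
    rw [← (hg ε' h4).1] at h3
    exact (hmono ε').lt_iff_lt.1 h3
  · have : f 0 x₀ < f ε c := by rw [← h1]; exact hmono ε hcg
    filter_upwards [mem_nhdsWithin_of_mem_nhds ((hc c).continuousAt.eventually_const_lt this),
      self_mem_nhdsWithin] with ε' h3 h4
    rw [← (hg ε' h4).1] at h3
    exact (hmono ε').lt_iff_lt.1 h3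

/-- The rings with a prescribed uniformizing variable can be continued to all moduli close to `1`. -/
theorem exists_uniformizer_eq {x₀ : ℝ} (hx₀ : 0 < x₀) :
    ∃ δ > 0, ∃ g : ℝ → ℝ, g 0 = x₀ ∧ ContinuousOn g (Set.Ico 0 δ) ∧
      ∀ ε ∈ Set.Ico 0 δ, ε ≤ 1 →
        uniformizer (1 - ε) (innerRadius (g ε)) = uniformizer 1 (innerRadius x₀) := by
  -- For q = 1 the integrand is singular at π/2. Cutting the radicand off below at `c` makes the
  -- integrand continuous and positive everywhere, without changing it in the range that belongs to
  -- 0 < x < x₀ + 1.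
  set c : ℝ := 1 - Real.tanh (x₀ + 1) ^ 2 with hc
  have hc0 : 0 < c := sub_pos.2 (Real.tanh_sq_lt_one _)
  let k : ℝ → ℝ → ℝ := fun ε t => 1 / √(max (1 - (1 - ε) ^ 2 * Real.sin t ^ 2) c)
  have hpos : ∀ ε t, 0 < √(max (1 - (1 - ε) ^ 2 * Real.sin t ^ 2) c) := fun ε t =>
    Real.sqrt_pos.2 (lt_max_of_lt_right hc0)
  have hk : Continuous k.uncurry := by
    refine Continuous.div continuous_const ?_ fun p => (hpos p.1 p.2).ne'
    fun_prop
  have hkε : ∀ ε, Continuous (k ε) := fun ε => hk.comp (by fun_prop : Continuous fun t => (ε, t))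
  have hs : Continuous fun x => Real.arcsin (Real.tanh x) :=
    Real.continuous_arcsin.comp contDiff_tanh.continuous
  let f : ℝ → ℝ → ℝ := fun ε x => ∫ t in (0 : ℝ)..Real.arcsin (Real.tanh x), k ε t
  have hf : Continuous f.uncurry := by
    refine intervalIntegral.continuous_parametric_intervalIntegral_of_continuous
      (f := fun p : ℝ × ℝ => k p.1) ?_ (hs.comp continuous_snd)
    exact hk.comp (by fun_prop : Continuous fun p : (ℝ × ℝ) × ℝ => (p.1.1, p.2))
  have hmono : ∀ ε, StrictMono (f ε) := fun ε x y hxy => by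
    have hlt : Real.arcsin (Real.tanh x) < Real.arcsin (Real.tanh y) := by
      refine Real.strictMonoOn_arcsin ⟨(Real.neg_one_lt_tanh x).le, (Real.tanh_lt_one x).le⟩
        ⟨(Real.neg_one_lt_tanh y).le, (Real.tanh_lt_one y).le⟩ ?_
      exact strictMono_tanh hxy
    rw [← sub_pos, intervalIntegral.integral_interval_sub_left ((hkε ε).intervalIntegrable _ _)
      ((hkε ε).intervalIntegrable _ _)]
    exact intervalIntegral.intervalIntegral_pos_of_pos ((hkε ε).intervalIntegrable _ _)
      (fun t => div_pos one_pos (hpos ε t)) hlt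
  have hfu : ∀ ε ∈ Set.Icc (0 : ℝ) 1, ∀ x ∈ Set.Ioo 0 (x₀ + 1),
      uniformizer (1 - ε) (innerRadius x) = f ε x := by
    intro ε hε x hx
    rw [uniformizer, innerRadius, ← Real.arcsin_eq_pi_div_two_sub_arccos, ellipticF]
    refine intervalIntegral.integral_congr fun t ht => ?_
    have h0 := Real.arcsin_nonneg.2 (tanh_pos_of_pos hx.1).le
    rw [Set.uIcc_of_le h0] at ht
    have h1 : 0 ≤ Real.sin t := Real.sin_nonneg_of_nonneg_of_le_pi ht.1
      (by linarith [ht.2, Real.arcsin_le_pi_div_two (Real.tanh x), Real.pi_pos])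
    have h2 : Real.sin t ≤ Real.tanh (x₀ + 1) := by
      refine le_trans ?_ (strictMono_tanh hx.2).le
      rw [← Real.le_arcsin_iff_sin_le' ⟨by linarith [ht.1, Real.pi_pos],
        by linarith [ht.2, Real.arcsin_le_pi_div_two (Real.tanh x)]⟩]
      exact ht.2
    have h3 : (1 - ε) ^ 2 * Real.sin t ^ 2 ≤ Real.tanh (x₀ + 1) ^ 2 := by
      have : (1 - ε) ^ 2 ≤ 1 := by nlinarith [hε.1, hε.2]
      have : Real.sin t ^ 2 ≤ Real.tanh (x₀ + 1) ^ 2 := by gcongr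
      nlinarith [sq_nonneg (Real.sin t)]
    simp only [k]
    rw [max_eq_left (by rw [hc]; linarith)]
  obtain ⟨δ, hδ, g, h0, hgc, hg⟩ := exists_continuous_root hf hmono hx₀ (lt_add_one x₀)
  refine ⟨δ, hδ, g, h0, hgc, fun ε hε h1 => ?_⟩
  have := hfu 0 ⟨le_rfl, zero_le_one⟩ x₀ ⟨hx₀, lt_add_one x₀⟩
  rw [sub_zero] at this
  rw [this, hfu ε ⟨hε.1, h1⟩ _ (hg ε hε).2, (hg ε hε).1]

/-- The variables that keep the uniformizing variables of a circle pattern fixed. -/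
theorem exists_prescribed {Q : SquareComplex} {C : Rings} (hC : IsCirclePattern Q C) :
    ∃ ε₁ : ℝ, 0 < ε₁ ∧ ε₁ ≤ 1 ∧ ∃ ξ : ℝ → ℤ × ℤ → ℝ,
      (∀ v ∈ ringVertices Q, ξ 0 v = uniformizer 1 (C.R v)) ∧
      (∀ v ∈ ringVertices Q, ContinuousOn (fun ε => ξ ε v) (Set.Ico 0 ε₁)) ∧
      ∀ ε ∈ Set.Ico 0 ε₁, ∀ v ∈ ringVertices Q,
        uniformizer (1 - ε) (innerRadius (ξ ε v)) = uniformizer 1 (C.R v) := by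
  have key : ∀ v, ∃ δ : ℝ, ∃ g : ℝ → ℝ, v ∈ ringVertices Q → 0 < δ ∧
      g 0 = uniformizer 1 (C.R v) ∧ ContinuousOn g (Set.Ico 0 δ) ∧
      ∀ ε ∈ Set.Ico 0 δ, ε ≤ 1 →
        uniformizer (1 - ε) (innerRadius (g ε)) = uniformizer 1 (C.R v) := fun v => by
    by_cases hv : v ∈ ringVertices Q
    · have hR := hC.radius_mem hv
      obtain ⟨δ, hδ, g, h⟩ := exists_uniformizer_eq (uniformizer_pos hR)
      rw [innerRadius_uniformizer hR] at h
      exact ⟨δ, g, fun _ => ⟨hδ, h⟩⟩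
    · exact ⟨0, 0, fun h => absurd h hv⟩
  choose δ g hg using key
  -- A common interval for the finitely many rings; the bound 1 keeps q = 1 - ε positive on it.
  have hev : ∀ᶠ ε in 𝓝[>] (0 : ℝ), (∀ v ∈ ringVertices Q, ε ≤ δ v) ∧ ε ≤ 1 ∧ 0 < ε :=
    ((Filter.eventually_all_finset _).2 fun v hv =>
      mem_nhdsWithin_of_mem_nhds (Iic_mem_nhds (hg v hv).1)).and
      (Filter.Eventually.and (mem_nhdsWithin_of_mem_nhds (Iic_mem_nhds one_pos))
        self_mem_nhdsWithin)
  obtain ⟨ε₁, h1, h2, h3⟩ := hev.exists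
  refine ⟨ε₁, h3, h2, fun ε v => g v ε, fun v hv => (hg v hv).2.1, fun v hv => ?_,
    fun ε hε v hv => ?_⟩
  · exact (hg v hv).2.2.1.mono (Set.Ico_subset_Ico_right (h1 v hv))
  · exact (hg v hv).2.2.2 ε ⟨hε.1, hε.2.trans_le (h1 v hv)⟩ (hε.2.le.trans h2)

theorem innerRings_subset_freeRings (B : BoundaryProblem) (Q : SquareComplex) :
    innerRings Q ⊆ B.freeRings Q := by
  cases B with
  | dirichlet b => exact subset_rfl
  | neumann Θ => exact Finset.filter_subset _ _

theorem valence_sub_phi_inner (B : BoundaryProblem) {Q : SquareComplex} {v : ℤ × ℤ}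
    (hv : v ∈ innerRings Q) : π * valence Q v - B.phi Q v = 2 * π := by
  unfold BoundaryProblem.phi
  rw [if_pos hv, (Finset.mem_filter.1 hv).2]
  push_cast
  ring

end RingPattern

end

/-! ### Assembly of the family -/

open RingPattern

theorem mainTheorem9 (Q : RingPattern.SquareComplex) (hQ : RingPattern.SimplyConnected Q)
    (B : RingPattern.BoundaryProblem) (C : RingPattern.Rings)
    (hC : RingPattern.IsCirclePattern Q C) (hB : B.Holds Q C 1) (hrigid : B.Rigid Q C) :
    ∃ ε₀ : ℝ, 0 < ε₀ ∧ ∃ P : ℝ → RingPattern.Rings,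
      P 0 = C ∧
      (∀ ε ∈ Set.Ico 0 ε₀,
        RingPattern.IsRingPattern Q (P ε) ∧
        RingPattern.HasParameter Q (P ε) (1 - ε) ∧
        B.Holds Q (P ε) (1 - ε)) ∧
      (∀ v ∈ RingPattern.ringVertices Q,
        ContinuousOn (fun ε => (P ε).r v) (Set.Ico 0 ε₀) ∧
        ContinuousOn (fun ε => (P ε).R v) (Set.Ico 0 ε₀) ∧
        ContinuousOn (fun ε => (P ε).center v) (Set.Ico 0 ε₀)) ∧
      (∀ v ∈ RingPattern.pointVertices Q,
        ContinuousOn (fun ε => (P ε).point v) (Set.Ico 0 ε₀)) := by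
  classical
  obtain ⟨ε₁, hε₁, hle, ξ, hξ0, hξc, hξ⟩ := exists_prescribed hC
  obtain ⟨δ, hδ, β, β0, βc, hβ⟩ := exists_variables hC hB hrigid hε₁ hξc hξ0
  have hδ1 : ∀ ε ∈ Set.Ico 0 δ, 1 - ε ∈ Set.Ioc (0 : ℝ) 1 := fun ε hε =>
    ⟨by linarith [hε.2, hδ.2], by linarith [hε.1]⟩
  -- Away from the ring vertices the values of `C` are kept, so that the family starts at `C` as a
  -- whole.
  let r : ℝ → ℤ × ℤ → ℝ := fun ε v => if v ∈ ringVertices Q then innerRadius (β ε v) else C.r v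
  let R : ℝ → ℤ × ℤ → ℝ := fun ε v =>
    if v ∈ ringVertices Q then outerRadius (1 - ε) (β ε v) else C.R v
  have er : ∀ ε, ∀ v ∈ ringVertices Q, r ε v = innerRadius (β ε v) := fun ε v hv => if_pos hv
  have eR : ∀ ε, ∀ v ∈ ringVertices Q, R ε v = outerRadius (1 - ε) (β ε v) :=
    fun ε v hv => if_pos hv
  have hr0 : r 0 = C.r := funext fun v => by
    by_cases hv : v ∈ ringVertices Q
    · rw [er 0 v hv, β0, innerRadius_uniformizer (hC.radius_mem hv), hC.2 v hv]
    · exact if_neg hv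
  have hR0 : R 0 = C.R := funext fun v => by
    by_cases hv : v ∈ ringVertices Q
    · rw [eR 0 v hv, β0, sub_zero, outerRadius_one, innerRadius_uniformizer (hC.radius_mem hv)]
    · exact if_neg hv
  have hsum : ∀ ε ∈ Set.Ico 0 δ, ∀ v ∈ B.freeRings Q,
      kiteSum Q (r ε) (R ε) v = π * valence Q v - B.phi Q v := fun ε hε v hv => by
    rw [← (hβ ε hε).2.1 v hv]
    exact kiteSum_congr (er ε) (eR ε) (freeRings_subset B Q hv)
  have hrc : ∀ v ∈ ringVertices Q, ContinuousOn (fun ε => r ε v) (Set.Ico 0 δ) := fun v hv => by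
    simp only [er _ v hv, innerRadius]
    exact Real.continuous_arccos.comp_continuousOn
      (contDiff_tanh.continuous.comp_continuousOn (βc v hv))
  have hRc : ∀ v ∈ ringVertices Q, ContinuousOn (fun ε => R ε v) (Set.Ico 0 δ) := fun v hv => by
    simp only [eR _ v hv, outerRadius]
    exact Real.continuous_arccos.comp_continuousOn ((by fun_prop : ContinuousOn _ _).mul
      (contDiff_tanh.continuous.comp_continuousOn (βc v hv)))
  have hq : ∀ ε ∈ Set.Ico 0 δ, ∀ v ∈ ringVertices Q,
      (1 - ε) * Real.cos (r ε v) = Real.cos (R ε v) := fun ε hε v hv => by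
    rw [er ε v hv, eR ε v hv, cos_outerRadius (hδ1 ε hε)]
  obtain ⟨P, hP0, hPr, hPR, hP, hPc, hPp⟩ := hC.exists_deformation hQ (I := Set.Ico 0 δ)
    ⟨le_rfl, hδ.1⟩ hr0 hR0
    (fun ε hε v hv => by rw [er ε v hv]; exact innerRadius_mem ((hβ ε hε).1 v hv))
    (fun ε hε v hv => by rw [eR ε v hv]; exact outerRadius_mem (hδ1 ε hε) ((hβ ε hε).1 v hv))
    (fun ε hε v hv => by
      rw [er ε v hv, eR ε v hv]
      exact innerRadius_le_outerRadius (hδ1 ε hε) ((hβ ε hε).1 v hv))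
    (fun ε hε => ⟨1 - ε, hq ε hε⟩) hrc hRc
    (fun ε hε v hv => by rw [hsum ε hε v (innerRings_subset_freeRings B Q hv),
      valence_sub_phi_inner B hv])
  refine ⟨δ, hδ.1, P, hP0, fun ε hε => ⟨(hP ε hε).1, fun v hv => ?_, ?_⟩, fun v hv => ⟨?_, ?_, hPc v⟩,
    fun v _ => hPp v⟩
  · rw [hPr, hPR]; exact hq ε hε v hv
  · cases B with
    | dirichlet b =>
      intro v hv
      obtain ⟨hv1, hv2⟩ := Finset.mem_filter.1 hv
      have hvf : v ∉ (BoundaryProblem.dirichlet b).freeRings Q := fun h =>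
        hv2.ne (Finset.mem_filter.1 h).2
      have := hξ ε ⟨hε.1, hε.2.trans_le hδ.2⟩ v hv1
      -- In the Dirichlet problem the boundary rings follow the curve ξ, along which the
      -- uniformizing variable is constant.
      rw [hPr, er ε v hv1, (hβ ε hε).2.2 v hv1 hvf, this, ← hC.2 v hv1, hB v hv]
    | neumann Θ =>
      intro v hv
      obtain ⟨hv1, hv2⟩ := Finset.mem_filter.1 hv
      -- In the Neumann problem every ring is free, so the continued cone angles are those of `C`.
      rw [(hP ε hε).2 v hv1, hsum ε hε v hv1, ← hC.kiteSum_eq hB hv1, ← hC.coneAngle_eq hv1,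
        hB v hv]
  · simpa only [hPr] using hrc v hv
  · simpa only [hPR] using hRc v hv
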